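/- For $z\in\mathbb{C}$ and $s>r>0$ let $B_r(z)$ be the open disc and $B_{r,s}(z)=\{w\in\mathbb{C}: r<|w-z|<s\}$. For $\Delta\ge\delta>0$ let $\mathcal{H}(B_s(z),B_r(z),\delta,\Delta)$ be the set of all $F\in C^1(B_s(z))$ (complex valued, continuously differentiable in the real sense) with $|F|\le\Delta$ on $B_s(z)$, with $|\nabla|F||\le\Delta$ at every point of $B_s(z)$ at which $|F|$ is differentiable, and with $|F|\ge\delta$ on $B_{r,s}(z)$. For a continuous $\eta:B_s(z)\to\mathbb{C}$ which does not vanish identically on $\partial B_r(z)$ put $$\operatorname{var}(\eta,B_r(z))=\frac{\max_{w\in\partial B_r(z)}|\eta(w)|}{\inf_{w\in B_r(z)}|\eta(w)|}\in(0,\infty],$$ which is $\infty$ if the denominator is $0$. For an open set $\Omega\subset\mathbb{C}=\mathbb{R}^2$ and real-valued $u$ let $\|u\|_{W^{1,2}(\Omega)}=\|u\|_{L^2(\Omega)}+\|\nabla u\|_{L^2(\Omega)}$, with $\nabla u$ the weak gradient, and $\|u\|_{W^{1,2}(\Omega)}=\infty$ if $u\notin W^{1,2}(\Omega)$. **Theorem.**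 There exist a continuous function $\rho:[0,1)\to(0,\infty)$ with $\lim_{t\to1^-}\rho(t)=\infty$ and a constant $c>0$ (both universal, that is, independent of all the data below) such that the following holds. Let $z\in\mathbb{C}$, $s>r>0$, $\Delta\ge\delta>0$, $F_1\in\mathcal{H}(B_s(z),B_r(z),\delta,\Delta)$ and $F_2\in C^1(B_s(z))$, and let $\eta:B_s(z)\to\mathbb{C}$ be continuous, not identically zero on $\partial B_r(z)$, and such that $\eta F_1$ and $\eta F_2$ are holomorphic on $B_s(z)$. Then $$\inf_{\alpha\in\mathbb{R}}\|F_1-e^{i\alpha}F_2\|_{L^2(B_s(z))}\le c\,\bigl(1+\rho(r/s)\,s\bigr)\Bigl(1+r^{1/2}\rho(r/s)\bigl(s^{1/2}+s^{-1/2}\bigr)\operatorname{var}(\eta,B_r(z))\Bigr)\frac{\Delta^2}{\delta^2}\,\bigl\||F_1|-|F_2|\bigr\|_{W^{1,2}(B_{r,s}(z))}.$$ Both sides take values in $[0,\infty]$, with the convention $\infty\cdot0=0$. -/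

import Mathlib

open Set Filter Topology MeasureTheory
open scoped ENNReal ContDiff

noncomputable section

/-- The open annulus `B_{r,s}(z) = {w : r < |w - z| < s}`. -/
def annulus (z : ℂ) (r s : ℝ) : Set ℂ := {w | r < ‖w - z‖ ∧ ‖w - z‖ < s}

/-- The atoll domain `D₊ = D \ ⋃ i, closure (D₀ i)`. -/
def atollDomain (D : Set ℂ) {l : ℕ} (D₀ : Fin l → Set ℂ) : Set ℂ :=
  D \ ⋃ i, closure (D₀ i)

/-- The class `ℋ(D, (D₀ⁱ), δ, Δ)` of atoll functions: `F ∈ C¹(D)`, `|F| ≤ Δ` and `|∇|F|| ≤ Δ`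
on `D`, and `|F| ≥ δ` on `D₊`. The function `|F|` is differentiable at least wherever `F ≠ 0`; at a
point where it is not differentiable `gradient` is `0`, so that the gradient bound is required
exactly at the points where `∇|F|` exists. -/
structure IsAtollFunction (D : Set ℂ) {l : ℕ} (D₀ : Fin l → Set ℂ) (δ Δ : ℝ) (F : ℂ → ℂ) :
    Prop where
  contDiffOn : ContDiffOn ℝ 1 F D
  norm_le : ∀ w ∈ D, ‖F w‖ ≤ Δ
  norm_gradient_le : ∀ w ∈ D, ‖gradient (fun v : ℂ => ‖F v‖) w‖ ≤ Δ
  le_norm : ∀ w ∈ atollDomain D D₀, δ ≤ ‖F w‖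

/-- `g` is a weak gradient of the real function `u` on the open set `Ω ⊆ ℂ = ℝ²`;
the vector `(a, b) ∈ ℝ²` is written as the complex number `a + b i`. -/
structure HasWeakGradientOn (u : ℂ → ℝ) (g : ℂ → ℂ) (Ω : Set ℂ) : Prop where
  locallyIntegrableOn : LocallyIntegrableOn u Ω volume
  locallyIntegrableOn_gradient : LocallyIntegrableOn g Ω volume
  integral_eq : ∀ φ : ℂ → ℝ, ContDiff ℝ ∞ φ → HasCompactSupport φ → tsupport φ ⊆ Ω →
    ∀ v : ℂ, ∫ w in Ω, u w * fderiv ℝ φ w v = -∫ w in Ω, inner ℝ (g w) v * φ w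

/-- The norm `‖u‖_{L²(Ω)} + ‖∇u‖_{L²(Ω)}` of the Sobolev space `W^{1,2}(Ω)`, equal to `∞` if `u`
does not belong to that space. The weak gradient is unique up to null sets, so the infimum only
selects it, and it is `∞` if there is none. -/
def sobolevNorm (u : ℂ → ℝ) (Ω : Set ℂ) : ℝ≥0∞ :=
  ⨅ (g : ℂ → ℂ) (_ : HasWeakGradientOn u g Ω),
    eLpNorm u 2 (volume.restrict Ω) + eLpNorm g 2 (volume.restrict Ω)

/-- `var(η, D₀) = max_{∂D₀} |η| / min_{D₀} |η|`, equal to `∞` if the denominator is `0` and the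
numerator is not. -/
def etaVar (η : ℂ → ℂ) (D₀ : Set ℂ) : ℝ≥0∞ :=
  (⨆ w ∈ frontier D₀, ‖η w‖ₑ) / ⨅ w ∈ D₀, ‖η w‖ₑ

end

/-! ### Circles and polar coordinates -/

/-! Everything runs through the quotient `h = F₂ / F₁`. Since `|F₁| ≥ δ` persists on the circle `|w
- z| = r` and `η` is nonzero somewhere on it, `η F₁` is holomorphic and not identically zero, so the
zeros of `η` are isolated. Off them `h = (η F₂) / (η F₁)`, and continuity removes the singularities:
`h` is holomorphic wherever `F₁ ≠ 0`, in particular on the annulus and near its inner circle.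

On the annulus put `u = |F₁| - |F₂|`, so that `1 - |h| = u / |F₁|`. A holomorphic function satisfies
`|h'| = |∇|h||` off its zeros, so differentiating `|F₂| = |F₁| |h|` bounds `h'` by `u` and `∇u`
(`eLpNorm_deriv_div_le`): control of the moduli becomes control of the phase. By Cauchy's theorem
all circle averages of `h` equal one number `a`, so Poincaré's inequality on each circle already
bounds `h - a` on the annulus. As `|h|` is close to 1, `a` can be replaced by some `e^{-iα}`
(`exists_phase_estimate`), and `F₁ - e^{iα} F₂ = -e^{iα} F₁ (h - e^{-iα})` is small there.

In the inner disc `F₁` may vanish, but `η (F₁ - e^{iα} F₂)` is holomorphic, so its `L²` norm is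
controlled by its values on the boundary circle (`lintegral_enorm_sq_ball_le`), and these by the
trace inequality for `h - e^{-iα}` (`lintegral_enorm_sq_circle_le`). Removing `η` costs the factor
`var`. If `inf |η| = 0`, the right-hand side is infinite unless the Sobolev norm is zero, and then
the identity theorem gives `F₁ = e^{iα} F₂` on the whole disc. -/

theorem isOpen_annulus (z : ℂ) (r s : ℝ) : IsOpen (annulus z r s) :=
  have h : Continuous fun w : ℂ => ‖w - z‖ := by fun_prop
  (isOpen_lt continuous_const h).inter (isOpen_lt h continuous_const)

theorem circleMap_mem_annulus_iff {z : ℂ} {r s R θ : ℝ} (hR : 0 ≤ R) :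
    circleMap z R θ ∈ annulus z r s ↔ R ∈ Ioo r s := by
  simp [annulus, abs_of_nonneg hR]

theorem circleAverage_eq_integral_neg_pi_pi {E : Type*} [NormedAddCommGroup E] [NormedSpace ℝ E]
    (f : ℂ → E) (z : ℂ) (R : ℝ) :
    Real.circleAverage f z R =
      (2 * Real.pi)⁻¹ • ∫ θ in (-Real.pi)..Real.pi, f (circleMap z R θ) := by
  rw [Real.circleAverage_eq_integral_add (-Real.pi),
    intervalIntegral.integral_comp_add_right (fun θ => f (circleMap z R θ))]
  congr 2 <;> ring

/-- The average over a circle of a function holomorphic on a closed annulus does not depend on the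
radius. -/
theorem circleAverage_eq_of_differentiable_on_annulus {E : Type*} [NormedAddCommGroup E]
    [NormedSpace ℂ E] [CompleteSpace E] {f : ℂ → E} {z : ℂ} {r R : ℝ} (hr : 0 < r) (hrR : r ≤ R)
    (hc : ContinuousOn f (Metric.closedBall z R \ Metric.ball z r))
    (hd : ∀ w ∈ Metric.ball z R \ Metric.closedBall z r, DifferentiableAt ℂ f w) :
    Real.circleAverage f z R = Real.circleAverage f z r := by
  rw [Real.circleAverage_eq_circleIntegral (hr.trans_le hrR).ne',
    Real.circleAverage_eq_circleIntegral hr.ne',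
    Complex.circleIntegral_sub_center_inv_smul_eq_of_differentiable_on_annulus_off_countable hr hrR
      countable_empty hc fun w hw => hd w hw.1]

theorem lintegral_annulus {f : ℂ → ℝ≥0∞} (hf : Measurable f) (z : ℂ) {r s : ℝ} (hr : 0 ≤ r) :
    ∫⁻ w in annulus z r s, f w = ∫⁻ R in Ioo r s, ENNReal.ofReal R *
      ∫⁻ θ in Ioo (-Real.pi) Real.pi, f (circleMap z R θ) := by
  have hA := (isOpen_annulus z r s).measurableSet
  have hcm : ∀ p : ℝ × ℝ, z + Complex.polarCoord.symm p = circleMap z p.1 p.2 := fun p => by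
    rw [Complex.polarCoord_symm_apply, circleMap, Complex.exp_mul_I]
    push_cast; ring
  have hcont : Continuous fun p : ℝ × ℝ => circleMap z p.1 p.2 := by
    unfold circleMap; fun_prop
  -- Translation invariance moves the centre to the origin, where polar coordinates apply.
  rw [← lintegral_indicator hA, ← lintegral_add_left_eq_self _ z,
    ← Complex.lintegral_comp_polarCoord_symm]
  simp_rw [hcm]
  rw [show polarCoord.target = Ioi (0 : ℝ) ×ˢ Ioo (-Real.pi) Real.pi from rfl,
    Measure.volume_eq_prod, ← Measure.prod_restrict, lintegral_prod]
  · rw [← inter_eq_self_of_subset_right (show Ioo r s ⊆ Ioi 0 from fun x hx => hr.trans_lt hx.1),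
      inter_comm, ← Measure.restrict_restrict measurableSet_Ioo,
      ← lintegral_indicator measurableSet_Ioo]
    refine setLIntegral_congr_fun measurableSet_Ioi fun R hR => ?_
    have hR' : 0 ≤ R := le_of_lt hR
    by_cases h : R ∈ Ioo r s
    · simp only [smul_eq_mul]
      rw [indicator_of_mem h, lintegral_const_mul']
      · congr 1
        refine lintegral_congr fun θ => ?_
        rw [indicator_of_mem ((circleMap_mem_annulus_iff hR').2 h)]
      · exact ENNReal.ofReal_ne_top
    · rw [indicator_of_notMem h]
      simp [indicator_of_notMem (fun h' => h ((circleMap_mem_annulus_iff hR').1 h'))]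
  · refine Measurable.aemeasurable ?_
    exact (measurable_fst.ennreal_ofReal).smul ((hf.indicator hA).comp hcont.measurable)

theorem lintegral_enorm_sq_annulus {f : ℂ → ℂ} {z : ℂ} {r s : ℝ} (hr : 0 ≤ r)
    (hf : ContinuousOn f (annulus z r s)) :
    ∫⁻ w in annulus z r s, ‖f w‖ₑ ^ 2 = ∫⁻ R in Ioo r s, ENNReal.ofReal R *
      ∫⁻ θ in Ioo (-Real.pi) Real.pi, ‖f (circleMap z R θ)‖ₑ ^ 2 := by
  classical
  have hA := (isOpen_annulus z r s).measurableSet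
  have hm : Measurable ((annulus z r s).indicator f) := by
    rw [← piecewise_eq_indicator]
    exact hf.measurable_piecewise continuousOn_const hA
  have h1 := lintegral_annulus (f := fun w => ‖(annulus z r s).indicator f w‖ₑ ^ 2)
    (hm.enorm.pow_const 2) z (s := s) hr
  rw [setLIntegral_congr_fun (g := fun w => ‖f w‖ₑ ^ 2) hA
    (fun w hw => by simp only [indicator_of_mem hw])] at h1
  rw [h1]
  refine setLIntegral_congr_fun measurableSet_Ioo fun R hR => ?_
  simp only [indicator_of_mem ((circleMap_mem_annulus_iff (hr.trans hR.1.le)).2 hR)]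

theorem sq_lintegral_le {α : Type*} [MeasurableSpace α] {μ : Measure α} {f : α → ℝ≥0∞}
    (hf : AEMeasurable f μ) : (∫⁻ x, f x ∂μ) ^ 2 ≤ μ univ * ∫⁻ x, f x ^ 2 ∂μ := by
  have h := ENNReal.lintegral_mul_le_Lp_mul_Lq μ Real.HolderConjugate.two_two
    (aemeasurable_const (b := (1 : ℝ≥0∞))) hf
  simp only [Pi.mul_apply, one_mul, lintegral_const, ENNReal.rpow_two, one_pow] at h
  calc _ ≤ _ := pow_le_pow_left' h 2
    _ = _ := by
      rw [mul_pow, ← ENNReal.rpow_natCast, ← ENNReal.rpow_natCast, ← ENNReal.rpow_mul,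
        ← ENNReal.rpow_mul]
      norm_num

/-- If `g` is differentiable on `[a, b]` with continuous derivative, the oscillation of `g` is
bounded by the integral of `‖g'‖`. -/
theorem enorm_sub_le_lintegral_deriv {g g' : ℝ → ℂ} {a b x y : ℝ}
    (hg : ∀ t ∈ Icc a b, HasDerivAt g (g' t) t) (hg' : ContinuousOn g' (Icc a b))
    (hx : x ∈ Icc a b) (hy : y ∈ Icc a b) :
    ‖g x - g y‖ₑ ≤ ∫⁻ t in Ioo a b, ‖g' t‖ₑ := by
  have hsub : uIcc y x ⊆ Icc a b := (convex_Icc a b).ordConnected.uIcc_subset hy hx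
  rw [← intervalIntegral.integral_eq_sub_of_hasDerivAt (fun t ht => hg t (hsub ht))
    (hg'.mono hsub).intervalIntegrable, restrict_Ioo_eq_restrict_Ioc]
  have : ‖∫ t in y..x, g' t‖ₑ = ‖∫ t in uIoc y x, g' t‖ₑ := by
    simp only [enorm_eq_iff_norm_eq, intervalIntegral.norm_intervalIntegral_eq]
  rw [this]
  refine (enorm_integral_le_lintegral_enorm _).trans (lintegral_mono_set ?_)
  rw [uIoc]
  exact Ioc_subset_Ioc (le_min hy.1 hx.1) (max_le hy.2 hx.2)

theorem hasDerivAt_comp_circleMap {f : ℂ → ℂ} {z : ℂ} {R θ : ℝ}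
    (hf : DifferentiableAt ℂ f (circleMap z R θ)) :
    HasDerivAt (fun t => f (circleMap z R t))
      (deriv f (circleMap z R θ) * (circleMap 0 R θ * Complex.I)) θ :=
  hf.hasDerivAt.comp θ (hasDerivAt_circleMap z R θ)

theorem hasDerivAt_comp_circleMap_radius {f : ℂ → ℂ} {z : ℂ} {R θ : ℝ}
    (hf : DifferentiableAt ℂ f (circleMap z R θ)) :
    HasDerivAt (fun t => f (circleMap z t θ))
      (deriv f (circleMap z R θ) * Complex.exp (θ * Complex.I)) R := by
  have h : HasDerivAt (fun t : ℝ => circleMap z t θ) (Complex.exp (θ * Complex.I)) R := by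
    unfold circleMap
    simpa using ((Complex.ofRealCLM.hasDerivAt (x := R)).mul_const
      (Complex.exp (θ * Complex.I))).const_add z
  exact hf.hasDerivAt.comp R h

/-- Poincaré's inequality on a circle. -/
theorem lintegral_enorm_sub_circleAverage_sq_le {f : ℂ → ℂ} {z : ℂ} {R : ℝ} (hR : 0 ≤ R)
    {U : Set ℂ} (hU : IsOpen U) (hf : DifferentiableOn ℂ f U) (hs : Metric.sphere z R ⊆ U) :
    ∫⁻ θ in Ioo (-Real.pi) Real.pi, ‖f (circleMap z R θ) - Real.circleAverage f z R‖ₑ ^ 2 ≤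
      ENNReal.ofReal (2 * Real.pi * R) ^ 2 *
        ∫⁻ θ in Ioo (-Real.pi) Real.pi, ‖deriv f (circleMap z R θ)‖ₑ ^ 2 := by
  have hmem : ∀ θ, circleMap z R θ ∈ U := fun θ => hs (circleMap_mem_sphere z hR θ)
  have hπ := Real.pi_pos
  have hcd : Continuous fun θ => deriv f (circleMap z R θ) :=
    (hf.deriv hU).continuousOn.comp_continuous (continuous_circleMap z R) hmem
  have hcf : Continuous fun θ => f (circleMap z R θ) :=
    hf.continuousOn.comp_continuous (continuous_circleMap z R) hmem
  set J : ℝ≥0∞ := ∫⁻ θ in Ioo (-Real.pi) Real.pi,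
    ‖deriv f (circleMap z R θ) * (circleMap 0 R θ * Complex.I)‖ₑ with hJ
  have hJ' : J = ENNReal.ofReal R * ∫⁻ θ in Ioo (-Real.pi) Real.pi,
      ‖deriv f (circleMap z R θ)‖ₑ := by
    rw [hJ, ← lintegral_const_mul' _ _ ENNReal.ofReal_ne_top]
    refine lintegral_congr fun θ => ?_
    rw [enorm_mul, mul_comm]
    congr 1
    rw [← ofReal_norm]
    simp [abs_of_nonneg hR]
  have hJtop : J ≠ ⊤ := by
    have h : IntegrableOn (fun θ => deriv f (circleMap z R θ) * (circleMap 0 R θ * Complex.I))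
        (Icc (-Real.pi) Real.pi) :=
      (hcd.mul ((continuous_circleMap 0 R).mul_const _)).continuousOn.integrableOn_Icc
    exact (h.mono_set Ioo_subset_Icc_self).2.ne
  -- Two values on the circle differ by at most the integral `J` of the tangential derivative, hence
  -- each differs from the average by at most `J`.
  have hosc : ∀ θ ∈ Icc (-Real.pi) Real.pi, ∀ θ' ∈ Icc (-Real.pi) Real.pi,
      ‖f (circleMap z R θ) - f (circleMap z R θ')‖ ≤ J.toReal := fun θ hθ θ' hθ' => by
    rw [← toReal_enorm]
    refine ENNReal.toReal_mono hJtop ?_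
    exact enorm_sub_le_lintegral_deriv (g := fun θ => f (circleMap z R θ))
      (fun t _ => hasDerivAt_comp_circleMap (hf.differentiableAt (hU.mem_nhds (hmem t))))
      (hcd.mul ((continuous_circleMap 0 R).mul_const _)).continuousOn hθ hθ'
  have havg : ∀ θ ∈ Icc (-Real.pi) Real.pi,
      ‖f (circleMap z R θ) - Real.circleAverage f z R‖ₑ ≤ J := fun θ hθ => by
    rw [← ENNReal.ofReal_toReal hJtop, ← ofReal_norm]
    refine ENNReal.ofReal_le_ofReal ?_
    have h1 : f (circleMap z R θ) - Real.circleAverage f z R = (2 * Real.pi)⁻¹ •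
        ∫ θ' in (-Real.pi)..Real.pi, (f (circleMap z R θ) - f (circleMap z R θ')) := by
      rw [circleAverage_eq_integral_neg_pi_pi, intervalIntegral.integral_sub
        (by simp) (hcf.intervalIntegrable _ _), intervalIntegral.integral_const, smul_sub,
        smul_smul, sub_neg_eq_add, ← two_mul, inv_mul_cancel₀ (by positivity), one_smul]
    rw [h1, norm_smul]
    have h2 := intervalIntegral.norm_integral_le_of_norm_le_const (a := -Real.pi) (b := Real.pi)
      (f := fun θ' => f (circleMap z R θ) - f (circleMap z R θ')) (C := J.toReal) fun θ' hθ' => by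
        rw [uIoc_of_le (by linarith)] at hθ'
        exact hosc θ hθ θ' ⟨hθ'.1.le, hθ'.2⟩
    rw [sub_neg_eq_add, ← two_mul, abs_of_pos (by positivity)] at h2
    calc _ ≤ ‖(2 * Real.pi)⁻¹‖ * (J.toReal * (2 * Real.pi)) := by gcongr
      _ = _ := by
        rw [Real.norm_of_nonneg (by positivity)]
        field_simp
  have hvol : (volume.restrict (Ioo (-Real.pi) Real.pi)) univ = ENNReal.ofReal (2 * Real.pi) := by
    simp [two_mul]
  calc _ ≤ ∫⁻ θ in Ioo (-Real.pi) Real.pi, J ^ 2 :=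
        setLIntegral_mono measurable_const fun θ hθ =>
          pow_le_pow_left' (havg θ ⟨hθ.1.le, hθ.2.le⟩) 2
    _ = ENNReal.ofReal (2 * Real.pi) * J ^ 2 := by
        rw [lintegral_const, hvol, mul_comm]
    _ ≤ ENNReal.ofReal (2 * Real.pi) * (ENNReal.ofReal R ^ 2 * (ENNReal.ofReal (2 * Real.pi) *
          ∫⁻ θ in Ioo (-Real.pi) Real.pi, ‖deriv f (circleMap z R θ)‖ₑ ^ 2)) := by
        rw [hJ', mul_pow, ← hvol]
        gcongr
        exact sq_lintegral_le hcd.measurable.enorm.aemeasurable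
    _ = _ := by
        rw [ENNReal.ofReal_mul (p := 2 * Real.pi) (by positivity)]
        ring

/-! ### Poincaré, trace and Hardy inequalities -/

theorem sphere_subset_annulus {z : ℂ} {r s R : ℝ} (hR : R ∈ Ioo r s) :
    Metric.sphere z R ⊆ annulus z r s := fun w hw => by
  rw [mem_sphere_iff_norm] at hw
  simpa [annulus, hw] using hR

/-- Poincaré's inequality for a holomorphic function on an annulus, whose circle averages are all
equal to `a`. -/
theorem lintegral_enorm_sub_sq_annulus_le {f : ℂ → ℂ} {z a : ℂ} {r s : ℝ} (hr : 0 ≤ r)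
    (hf : DifferentiableOn ℂ f (annulus z r s))
    (ha : ∀ R ∈ Ioo r s, Real.circleAverage f z R = a) :
    ∫⁻ w in annulus z r s, ‖f w - a‖ₑ ^ 2 ≤
      ENNReal.ofReal (2 * Real.pi * s) ^ 2 * ∫⁻ w in annulus z r s, ‖deriv f w‖ₑ ^ 2 := by
  have hA := isOpen_annulus z r s
  rw [lintegral_enorm_sq_annulus (f := fun w => f w - a) hr
      (hf.continuousOn.sub continuousOn_const),
    lintegral_enorm_sq_annulus hr (hf.deriv hA).continuousOn,
    ← lintegral_const_mul' _ _ (by finiteness)]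
  refine lintegral_mono_ae ((ae_restrict_iff' measurableSet_Ioo).2 (ae_of_all _ fun R hR => ?_))
  have hR0 : 0 ≤ R := hr.trans hR.1.le
  rw [← ha R hR, mul_left_comm]
  gcongr
  refine (lintegral_enorm_sub_circleAverage_sq_le hR0 hA hf (sphere_subset_annulus hR)).trans ?_
  gcongr
  exact hR.2.le

theorem add_sq_le_two_mul_add_two_mul (a b : ℝ≥0∞) : (a + b) ^ 2 ≤ 2 * a ^ 2 + 2 * b ^ 2 := by
  have := ENNReal.rpow_add_le_mul_rpow_add_rpow a b (p := 2) one_le_two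
  norm_num at this
  rwa [mul_add] at this

/-- The trace inequality: the `L²` norm on the inner circle is controlled by the Sobolev norm on
the annulus. -/
theorem lintegral_enorm_sq_circle_le {f : ℂ → ℂ} {z : ℂ} {r s : ℝ} (hr : 0 < r) (hrs : r < s)
    {U : Set ℂ} (hU : IsOpen U) (hf : DifferentiableOn ℂ f U)
    (hs : ∀ R ∈ Ico r s, Metric.sphere z R ⊆ U) :
    ENNReal.ofReal (r * (s - r)) * ∫⁻ θ in Ioo (-Real.pi) Real.pi, ‖f (circleMap z r θ)‖ₑ ^ 2 ≤
      2 * (∫⁻ w in annulus z r s, ‖f w‖ₑ ^ 2) +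
        2 * ENNReal.ofReal ((s - r) ^ 2) * ∫⁻ w in annulus z r s, ‖deriv f w‖ₑ ^ 2 := by
  have hAU : annulus z r s ⊆ U := fun w hw => hs ‖w - z‖ ⟨hw.1.le, hw.2⟩ (by simp)
  have hmem : ∀ R ∈ Ico r s, ∀ θ, circleMap z R θ ∈ U := fun R hR θ =>
    hs R hR (circleMap_mem_sphere z (hr.le.trans hR.1) θ)
  have hf' : ContinuousOn (deriv f) U := (hf.deriv hU).continuousOn
  rw [lintegral_enorm_sq_annulus hr.le (hf.continuousOn.mono hAU),
    lintegral_enorm_sq_annulus hr.le (hf'.mono hAU)]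
  set I := Ioo (-Real.pi) Real.pi with hI
  set Q := ∫⁻ θ in I, ‖f (circleMap z r θ)‖ₑ ^ 2 with hQ
  set E := ∫⁻ R in Ioo r s, ENNReal.ofReal R * ∫⁻ θ in I, ‖deriv f (circleMap z R θ)‖ₑ ^ 2 with hE
  have hcm : Continuous fun p : ℝ × ℝ => circleMap z p.1 p.2 := by unfold circleMap; fun_prop
  have hmR : ∀ θ, AEMeasurable (fun R => ‖deriv f (circleMap z R θ)‖ₑ)
      (volume.restrict (Ioo r s)) := fun θ => by
    refine ContinuousOn.aemeasurable (ContinuousOn.enorm (hf'.comp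
      (Continuous.continuousOn (by unfold circleMap; fun_prop)) fun R hR => ?_)) measurableSet_Ioo
    exact hmem R ⟨hR.1.le, hR.2⟩ θ
  -- The energy along rays carries the weight `r`, the area energy the polar weight `R ≥ r`.
  have hswap : ENNReal.ofReal r * (∫⁻ θ in I, ∫⁻ R in Ioo r s, ‖deriv f (circleMap z R θ)‖ₑ ^ 2)
      ≤ E := by
    rw [lintegral_lintegral_swap]
    · rw [← lintegral_const_mul' _ _ ENNReal.ofReal_ne_top]
      refine lintegral_mono_ae
        ((ae_restrict_iff' measurableSet_Ioo).2 (ae_of_all _ fun R hR => ?_))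
      gcongr
      exact hR.1.le
    · rw [Measure.prod_restrict]
      refine AEMeasurable.pow_const (ContinuousOn.aemeasurable (ContinuousOn.enorm (hf'.comp
        (hcm.comp continuous_swap).continuousOn fun p hp => ?_))
        (measurableSet_Ioo.prod measurableSet_Ioo)) 2
      exact hmem p.2 ⟨hp.2.1.le, hp.2.2⟩ p.1
  -- The inner circle is compared with the circle of radius `R` along each ray, by Cauchy–Schwarz.
  -- Integrating over `R` then produces the factor `s - r` on the left.
  have hpt : ∀ R ∈ Ioo r s, ENNReal.ofReal r * Q ≤
      2 * (ENNReal.ofReal R * ∫⁻ θ in I, ‖f (circleMap z R θ)‖ₑ ^ 2) +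
        2 * ENNReal.ofReal (s - r) * E := fun R hR => by
    have hosc : ∀ θ, ‖f (circleMap z r θ)‖ₑ ^ 2 ≤ 2 * ‖f (circleMap z R θ)‖ₑ ^ 2 +
        2 * (ENNReal.ofReal (s - r) *
          ∫⁻ ρ in Ioo r s, ‖deriv f (circleMap z ρ θ)‖ₑ ^ 2) := fun θ => by
      have h1 : ‖f (circleMap z r θ) - f (circleMap z R θ)‖ₑ ≤
          ∫⁻ ρ in Ioo r R, ‖deriv f (circleMap z ρ θ) * Complex.exp (θ * Complex.I)‖ₑ := by
        have hm : ∀ t ∈ Icc r R, circleMap z t θ ∈ U := fun t ht =>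
          hmem t ⟨ht.1, ht.2.trans_lt hR.2⟩ θ
        refine enorm_sub_le_lintegral_deriv (g := fun t => f (circleMap z t θ))
          (fun t ht => hasDerivAt_comp_circleMap_radius
            (hf.differentiableAt (hU.mem_nhds (hm t ht))))
          (ContinuousOn.mul (hf'.comp (Continuous.continuousOn (by unfold circleMap; fun_prop)) hm)
            continuousOn_const) ⟨le_rfl, hR.1.le⟩ ⟨hR.1.le, le_rfl⟩
      have h2 : ∀ ρ, ‖deriv f (circleMap z ρ θ) * Complex.exp (θ * Complex.I)‖ₑ =
          ‖deriv f (circleMap z ρ θ)‖ₑ := fun ρ => by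
        rw [enorm_eq_iff_norm_eq, norm_mul, Complex.norm_exp_ofReal_mul_I, mul_one]
      simp_rw [h2] at h1
      have h3 : ‖f (circleMap z r θ)‖ₑ ≤ ‖f (circleMap z R θ)‖ₑ +
          ∫⁻ ρ in Ioo r s, ‖deriv f (circleMap z ρ θ)‖ₑ := by
        calc _ = ‖f (circleMap z R θ) + (f (circleMap z r θ) - f (circleMap z R θ))‖ₑ := by
              rw [add_sub_cancel]
          _ ≤ _ := (enorm_add_le _ _).trans (by
              gcongr
              exact h1.trans (lintegral_mono_set (Ioo_subset_Ioo_right hR.2.le)))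
      refine (pow_le_pow_left' h3 2).trans ((add_sq_le_two_mul_add_two_mul _ _).trans ?_)
      gcongr
      refine (sq_lintegral_le (hmR θ)).trans (le_of_eq ?_)
      simp
    have hmeas : Measurable fun θ => 2 * ‖f (circleMap z R θ)‖ₑ ^ 2 :=
      ((hf.continuousOn.comp_continuous (continuous_circleMap z R)
        (hmem R ⟨hR.1.le, hR.2⟩)).measurable.enorm.pow_const 2).const_mul 2
    calc ENNReal.ofReal r * Q ≤ ENNReal.ofReal r * ∫⁻ θ in I, (2 * ‖f (circleMap z R θ)‖ₑ ^ 2 +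
          2 * (ENNReal.ofReal (s - r) *
          ∫⁻ ρ in Ioo r s, ‖deriv f (circleMap z ρ θ)‖ₑ ^ 2)) := by
          gcongr
          exact lintegral_mono hosc
      _ = 2 * (ENNReal.ofReal r * ∫⁻ θ in I, ‖f (circleMap z R θ)‖ₑ ^ 2) +
          2 * ENNReal.ofReal (s - r) * (ENNReal.ofReal r *
          ∫⁻ θ in I, ∫⁻ ρ in Ioo r s, ‖deriv f (circleMap z ρ θ)‖ₑ ^ 2) := by
          rw [lintegral_add_left hmeas, lintegral_const_mul' _ _ ENNReal.ofNat_ne_top,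
            lintegral_const_mul' _ _ ENNReal.ofNat_ne_top,
            lintegral_const_mul' _ _ ENNReal.ofReal_ne_top]
          ring
      _ ≤ _ := by
          gcongr
          exact hR.1.le
  have hsr : 0 ≤ s - r := by linarith
  have hvol : (volume.restrict (Ioo r s)) univ = ENNReal.ofReal (s - r) := by simp
  calc _ = ∫⁻ R in Ioo r s, ENNReal.ofReal r * Q := by
        rw [lintegral_const, hvol, ENNReal.ofReal_mul hr.le]
        ring
    _ ≤ ∫⁻ R in Ioo r s, (2 * (ENNReal.ofReal R * ∫⁻ θ in I, ‖f (circleMap z R θ)‖ₑ ^ 2) +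
        2 * ENNReal.ofReal (s - r) * E) :=
        lintegral_mono_ae ((ae_restrict_iff' measurableSet_Ioo).2 (ae_of_all _ hpt))
    _ = _ := by
        rw [lintegral_add_right _ measurable_const, lintegral_const, hvol,
          lintegral_const_mul' _ _ ENNReal.ofNat_ne_top, pow_two, ENNReal.ofReal_mul hsr]
        ring

/-! ### Fourier coefficients on concentric circles -/

theorem fourierCoeffOn_comp_circleMap (f : ℂ → ℂ) (z : ℂ) {R : ℝ} (hR : 0 < R) (n : ℤ) :
    fourierCoeffOn (neg_lt_self Real.pi_pos) (fun θ => f (circleMap z R θ)) n =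
      (R : ℂ) ^ n * Real.circleAverage (fun w => (w - z) ^ (-n) * f w) z R := by
  have hR' : (R : ℂ) ≠ 0 := by exact_mod_cast hR.ne'
  rw [fourierCoeffOn_eq_integral, circleAverage_eq_integral_neg_pi_pi, mul_smul_comm,
    ← intervalIntegral.integral_const_mul, sub_neg_eq_add, ← two_mul, one_div]
  congr 2
  ext θ
  rw [fourier_coe_apply, smul_eq_mul, ← mul_assoc]
  congr 1
  rw [circleMap_sub_center, circleMap_zero, mul_zpow, ← mul_assoc, zpow_neg,
    mul_inv_cancel₀ (zpow_ne_zero _ hR'), one_mul, ← Complex.exp_int_mul]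
  congr 1
  have : (Real.pi : ℂ) ≠ 0 := by exact_mod_cast Real.pi_ne_zero
  push_cast
  field_simp

/-- The Fourier coefficients of a holomorphic function on concentric circles increase in absolute
value with the radius. -/
theorem norm_fourierCoeffOn_comp_circleMap_le {f : ℂ → ℂ} {z : ℂ} {ρ r s : ℝ} (hρ : 0 < ρ)
    (hρr : ρ ≤ r) (hrs : r < s) (hf : DifferentiableOn ℂ f (Metric.ball z s)) (n : ℤ) :
    ‖fourierCoeffOn (neg_lt_self Real.pi_pos) (fun θ => f (circleMap z ρ θ)) n‖ ≤
      ‖fourierCoeffOn (neg_lt_self Real.pi_pos) (fun θ => f (circleMap z r θ)) n‖ := by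
  have hr := hρ.trans_le hρr
  rw [fourierCoeffOn_comp_circleMap f z hρ, fourierCoeffOn_comp_circleMap f z hr]
  obtain hn | hn := lt_or_ge n 0
  -- A negative index leads to `(w - z) ^ m * f w` with `m > 0`, whose average is its value 0 at the
  -- centre.
  · obtain ⟨m, hm⟩ := Int.eq_ofNat_of_zero_le (show 0 ≤ -n by omega)
    have hm0 : m ≠ 0 := by omega
    have h0 : Real.circleAverage (fun w => (w - z) ^ (-n) * f w) z ρ = 0 := by
      have hd : DifferentiableOn ℂ (fun w => (w - z) ^ m * f w) (Metric.ball z s) :=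
        ((differentiableOn_id.sub_const z).pow m).mul hf
      have := DiffContOnCl.circleAverage (c := z) (R := ρ) (f := fun w => (w - z) ^ m * f w)
        (hd.diffContOnCl_ball (U := Metric.ball z s) (by
          rw [abs_of_pos hρ]
          exact Metric.closedBall_subset_ball (hρr.trans_lt hrs)))
      rw [hm]
      simpa [hm0] using this
    rw [h0, mul_zero, norm_zero]
    positivity
  -- For `n ≥ 0` the average of `(w - z) ^ (-n) * f w` is the same on both circles; only the factor
  -- `R ^ n` grows.
  · have hd : ∀ w ∈ Metric.ball z s, w ≠ z →
        DifferentiableAt ℂ (fun w => (w - z) ^ (-n) * f w) w := fun w hw hwz =>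
      ((differentiableAt_id.sub_const z).zpow (Or.inl (sub_ne_zero.2 hwz))).mul
        (hf.differentiableAt (Metric.isOpen_ball.mem_nhds hw))
    rw [← circleAverage_eq_of_differentiable_on_annulus hρ hρr]
    · rw [norm_mul, norm_mul]
      gcongr
      rw [norm_zpow, norm_zpow, Complex.norm_real, Complex.norm_real, Real.norm_of_nonneg hρ.le,
        Real.norm_of_nonneg hr.le]
      exact zpow_le_zpow_left₀ hn hρ.le hρr
    · refine fun w hw =>
        (hd w (Metric.closedBall_subset_ball hrs hw.1) ?_).continuousAt.continuousWithinAt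
      rintro rfl
      exact hw.2 (Metric.mem_ball_self hρ)
    · refine fun w hw => hd w (Metric.ball_subset_ball hrs.le hw.1) ?_
      rintro rfl
      exact hw.2 (Metric.mem_closedBall_self hρ.le)

/-- Parseval's identity turns the comparison of coefficients into one of `L²` norms. -/
theorem lintegral_enorm_sq_circleMap_mono {f : ℂ → ℂ} {z : ℂ} {ρ r s : ℝ} (hρ : 0 < ρ)
    (hρr : ρ ≤ r) (hrs : r < s) (hf : DifferentiableOn ℂ f (Metric.ball z s)) :
    ∫⁻ θ in Ioo (-Real.pi) Real.pi, ‖f (circleMap z ρ θ)‖ₑ ^ 2 ≤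
      ∫⁻ θ in Ioo (-Real.pi) Real.pi, ‖f (circleMap z r θ)‖ₑ ^ 2 := by
  have hcont : ∀ R, 0 < R → R ≤ r → Continuous fun θ => f (circleMap z R θ) := fun R hR hRr =>
    hf.continuousOn.comp_continuous (continuous_circleMap z R) fun θ =>
      Metric.closedBall_subset_ball (hRr.trans_lt hrs)
        (Metric.sphere_subset_closedBall (circleMap_mem_sphere z hR.le θ))
  have hcoe : ∀ R, 0 < R → R ≤ r → ∫⁻ θ in Ioo (-Real.pi) Real.pi, ‖f (circleMap z R θ)‖ₑ ^ 2 =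
      ENNReal.ofReal (∫ θ in (-Real.pi)..Real.pi, ‖f (circleMap z R θ)‖ ^ 2) := fun R hR hRr => by
    rw [intervalIntegral.integral_of_le (neg_lt_self Real.pi_pos).le,
      ofReal_integral_eq_lintegral_ofReal, restrict_Ioo_eq_restrict_Ioc]
    · refine lintegral_congr fun θ => ?_
      rw [ENNReal.ofReal_pow (norm_nonneg _), ofReal_norm]
    · exact ((hcont R hR hRr).norm.pow 2).continuousOn.integrableOn_Icc.mono_set Ioc_subset_Icc_self
    · exact ae_of_all _ fun θ => by positivity
  have hsum : ∀ R, 0 < R → R ≤ r → _ := fun R hR hRr =>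
    hasSum_sq_fourierCoeffOn (f := fun θ => f (circleMap z R θ)) (neg_lt_self Real.pi_pos) (by
      rw [memLp_two_iff_integrable_sq_norm (hcont R hR hRr).aestronglyMeasurable]
      exact ((hcont R hR hRr).norm.pow 2).continuousOn.integrableOn_Icc.mono_set
        Ioc_subset_Icc_self)
  have hle := hasSum_le (fun n => pow_le_pow_left₀ (norm_nonneg _)
    (norm_fourierCoeffOn_comp_circleMap_le hρ hρr hrs hf n) 2) (hsum ρ hρ hρr)
    (hsum r (hρ.trans_le hρr) le_rfl)
  rw [hcoe ρ hρ hρr, hcoe r (hρ.trans_le hρr) le_rfl]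
  refine ENNReal.ofReal_le_ofReal ?_
  rw [smul_eq_mul, smul_eq_mul] at hle
  exact le_of_mul_le_mul_left hle (by linarith [inv_pos.2 Real.two_pi_pos, show
    (2 * Real.pi)⁻¹ = (Real.pi - -Real.pi)⁻¹ by rw [sub_neg_eq_add, two_mul]])

/-- The centre is a null set, so the polar formula for annuli also serves for discs. -/
theorem ball_ae_eq_annulus (z : ℂ) (r : ℝ) : Metric.ball z r =ᵐ[volume] annulus z 0 r := by
  have h : annulus z 0 r = Metric.ball z r \ {z} := by
    ext w
    simp [annulus, sub_ne_zero, and_comm, dist_eq_norm]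
  rw [h]
  exact (sdiff_null_ae_eq_self (measure_singleton z)).symm

/-- The `L²` norm of a holomorphic function on a disc is controlled by that on the boundary
circle. -/
theorem lintegral_enorm_sq_ball_le {f : ℂ → ℂ} {z : ℂ} {r s : ℝ} (hr : 0 < r) (hrs : r < s)
    (hf : DifferentiableOn ℂ f (Metric.ball z s)) :
    ∫⁻ w in Metric.ball z r, ‖f w‖ₑ ^ 2 ≤ ENNReal.ofReal (r ^ 2) *
      ∫⁻ θ in Ioo (-Real.pi) Real.pi, ‖f (circleMap z r θ)‖ₑ ^ 2 := by
  rw [setLIntegral_congr (ball_ae_eq_annulus z r), lintegral_enorm_sq_annulus le_rfl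
    (hf.continuousOn.mono fun w hw => by
      rw [mem_ball_iff_norm]
      exact hw.2.trans hrs)]
  calc _ ≤ ∫⁻ R in Ioo 0 r, ENNReal.ofReal r *
        ∫⁻ θ in Ioo (-Real.pi) Real.pi, ‖f (circleMap z r θ)‖ₑ ^ 2 := by
        refine lintegral_mono_ae
          ((ae_restrict_iff' measurableSet_Ioo).2 (ae_of_all _ fun R hR => ?_))
        gcongr ENNReal.ofReal ?_ * ?_
        · exact hR.2.le
        · exact lintegral_enorm_sq_circleMap_mono hR.1 hR.2.le hrs hf
    _ = _ := by
        rw [lintegral_const, Measure.restrict_apply_univ, Real.volume_Ioo, sub_zero, pow_two,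
          ENNReal.ofReal_mul hr.le]
        ring

/-! ### Weak gradients -/

theorem LocallyIntegrableOn.integrable_mul_of_tsupport_subset {k φ : ℂ → ℝ} {V : Set ℂ}
    (hk : LocallyIntegrableOn k V) (hφ : Continuous φ) (hc : HasCompactSupport φ)
    (hV : tsupport φ ⊆ V) : Integrable fun w => k w * φ w := by
  rw [← integrableOn_iff_integrable_of_support_subset (s := tsupport φ) fun w hw =>
    subset_tsupport φ (right_ne_zero_of_mul hw)]
  exact (hk.integrableOn_compact_subset hV hc).mul_continuousOn hφ.continuousOn hc

/-- A weak gradient agrees almost everywhere with the classical gradient where the latter exists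
and is continuous. -/
theorem HasWeakGradientOn.norm_fderiv_le_ae {u : ℂ → ℝ} {g : ℂ → ℂ} {Ω V : Set ℂ}
    (h : HasWeakGradientOn u g Ω) (hV : IsOpen V) (hVΩ : V ⊆ Ω) (hu : ContDiffOn ℝ 1 u V) :
    ∀ᵐ w, w ∈ V → ‖fderiv ℝ u w‖ ≤ ‖g w‖ := by
  have hu' : ContinuousOn (fderiv ℝ u) V := hu.continuousOn_fderiv_of_isOpen hV le_rfl
  -- Weak and classical integration by parts agree against every test function supported in `V`, so
  -- the two gradients have the same components almost everywhere. The directions `1` and `I`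
  -- suffice.
  have key : ∀ v : ℂ, ∀ᵐ w, w ∈ V → inner ℝ (g w) v - fderiv ℝ u w v = 0 := fun v => by
    have hgv : LocallyIntegrableOn (fun w => inner ℝ (g w) v) V := fun w hw => by
      obtain ⟨S, hS, hi⟩ := (h.locallyIntegrableOn_gradient.mono_set hVΩ) w hw
      exact ⟨S, hS, Integrable.inner_const hi v⟩
    have huv : LocallyIntegrableOn (fun w => fderiv ℝ u w v) V :=
      (hu'.clm_apply continuousOn_const).locallyIntegrableOn hV.measurableSet
    refine hV.ae_eq_zero_of_integral_contDiff_smul_eq_zero (hgv.sub huv) fun φ hφ hc hs => ?_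
    have hφc : Continuous φ := hφ.continuous
    have i1 := LocallyIntegrableOn.integrable_mul_of_tsupport_subset hgv hφc hc hs
    have i2 := LocallyIntegrableOn.integrable_mul_of_tsupport_subset huv hφc hc hs
    have i0 := LocallyIntegrableOn.integrable_mul_of_tsupport_subset
      (hu.continuousOn.locallyIntegrableOn hV.measurableSet) hφc hc hs
    have hφ'c : Continuous fun w => fderiv ℝ φ w v :=
      (hφ.continuous_fderiv (by simp)).clm_apply continuous_const
    have hsub : tsupport (fun w => fderiv ℝ φ w v) ⊆ tsupport φ :=
      tsupport_fderiv_apply_subset ℝ v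
    have i3 := LocallyIntegrableOn.integrable_mul_of_tsupport_subset
      (hu.continuousOn.locallyIntegrableOn hV.measurableSet) hφ'c
      (hc.fderiv_apply ℝ v) (hsub.trans hs)
    have hparts := integral_mul_fderiv_eq_neg_fderiv_mul_of_integrable (μ := volume) (f := u)
      (g := φ) (v := v) i2 i3 i0
      (fun w hw => (hu.contDiffAt (hV.mem_nhds (hs hw))).differentiableAt (by simp))
      (fun w _ => hφ.differentiable (by simp) w)
    have hweak := h.integral_eq φ hφ hc (hs.trans hVΩ) v
    rw [setIntegral_eq_integral_of_forall_compl_eq_zero,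
      setIntegral_eq_integral_of_forall_compl_eq_zero, hparts, neg_inj] at hweak
    · calc _ = ∫ w, (inner ℝ (g w) v * φ w - fderiv ℝ u w v * φ w) :=
            integral_congr_ae (ae_of_all _ fun w => by simp only [smul_eq_mul]; ring)
        _ = 0 := by rw [integral_sub i1 i2, hweak, sub_self]
    · intro w hw
      rw [image_eq_zero_of_notMem_tsupport fun hw' => hw (hVΩ (hs hw')), mul_zero]
    · intro w hw
      have := image_eq_zero_of_notMem_tsupport (f := fun w => fderiv ℝ φ w v)
        fun hw' => hw (hVΩ (hs (hsub hw')))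
      rw [this, mul_zero]
  filter_upwards [key 1, key Complex.I] with w h1 hI hw
  have h1 := sub_eq_zero.1 (h1 hw)
  have hI := sub_eq_zero.1 (hI hw)
  refine ContinuousLinearMap.opNorm_le_bound _ (norm_nonneg _) fun v => ?_
  have : fderiv ℝ u w v = inner ℝ (g w) v := by
    have hv : v = v.re • (1 : ℂ) + v.im • Complex.I := by
      simp
    rw [hv, map_add, map_smul, map_smul, inner_add_right, inner_smul_right, inner_smul_right,
      h1, hI]
    simp
  rw [this]
  exact norm_inner_le_norm _ _

/-- The modulus of the derivative of a holomorphic function is at most that of the gradient of its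
modulus. -/
theorem norm_deriv_le_norm_fderiv_norm {h : ℂ → ℂ} {w : ℂ} (hd : DifferentiableAt ℂ h w)
    (h0 : h w ≠ 0) : ‖deriv h w‖ ≤ ‖fderiv ℝ (fun v => ‖h v‖) w‖ := by
  obtain h' | h' := eq_or_ne (deriv h w) 0
  · rw [h', norm_zero]
    exact norm_nonneg _
  have hdR : DifferentiableAt ℝ h w := hd.restrictScalars ℝ
  have h1 := (hdR.norm ℝ h0).hasFDerivAt.pow 2
  have h2 := hd.hasDerivAt.hasFDerivAt.restrictScalars ℝ |>.norm_sq
  -- The direction `h / h'` moves the value `h w` radially: the derivative of `|h|²` along it is `2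
  -- |h|²`, so that of `|h|` is `|h|`.
  have h3 := congrArg (fun L => L (h w / deriv h w)) (h1.unique h2)
  have h4 : fderiv ℝ (fun v => ‖h v‖) w (h w / deriv h w) = ‖h w‖ := by
    have hn : ‖h w‖ ≠ 0 := norm_ne_zero_iff.2 h0
    simp [div_mul_cancel₀ _ h'] at h3
    have h5 : ‖h w‖ * (fderiv ℝ (fun v => ‖h v‖) w (h w / deriv h w)) = ‖h w‖ * ‖h w‖ := by
      linarith
    exact mul_left_cancel₀ hn h5
  have h5 := (fderiv ℝ (fun v => ‖h v‖) w).le_opNorm (h w / deriv h w)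
  rw [h4, norm_norm, norm_div] at h5
  have hp : 0 < ‖deriv h w‖ := norm_pos_iff.2 h'
  have hp' : 0 < ‖h w‖ := norm_pos_iff.2 h0
  rw [mul_div_assoc', le_div_iff₀ hp, mul_comm] at h5
  exact le_of_mul_le_mul_right h5 hp'

/-- With `h = F₂ / F₁` and `u = |F₁| - |F₂|`, the product rule for `|F₂| = |F₁| |h|` gives `|F₁|
∇|h| = (1 - |h|) ∇|F₁| - ∇u`. Only `∇|F₁|` enters, so `F₂` needs no gradient bound. -/
theorem norm_deriv_div_mul_le {F₁ F₂ : ℂ → ℂ} {w : ℂ} (hF₁ : DifferentiableAt ℝ F₁ w)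
    (hF₁c : ∀ᶠ v in 𝓝 w, F₁ v ≠ 0) (h0 : F₂ w ≠ 0)
    (hd : DifferentiableAt ℂ (fun v => F₂ v / F₁ v) w) :
    ‖deriv (fun v => F₂ v / F₁ v) w‖ * ‖F₁ w‖ ≤
      ‖fderiv ℝ (fun v => ‖F₁ v‖ - ‖F₂ v‖) w‖ +
        |1 - ‖F₂ w / F₁ w‖| * ‖gradient (fun v => ‖F₁ v‖) w‖ := by
  have h1 : F₁ w ≠ 0 := hF₁c.self_of_nhds
  have hq : F₂ w / F₁ w ≠ 0 := div_ne_zero h0 h1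
  have ha := (hF₁.norm ℝ h1).hasFDerivAt
  have hb := ((hd.restrictScalars ℝ).norm ℝ hq).hasFDerivAt
  have hu : (fun v => ‖F₁ v‖ - ‖F₂ v‖) =ᶠ[𝓝 w] fun v => ‖F₁ v‖ - ‖F₁ v‖ * ‖F₂ v / F₁ v‖ := by
    filter_upwards [hF₁c] with v hv
    rw [← norm_mul, mul_div_cancel₀ _ hv]
  rw [hu.fderiv_eq, HasFDerivAt.fderiv
    (show HasFDerivAt (fun v => ‖F₁ v‖ - ‖F₁ v‖ * ‖F₂ v / F₁ v‖) _ w from ha.sub (ha.mul hb)),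
     gradient, LinearIsometryEquiv.norm_map]
  set a' := fderiv ℝ (fun v => ‖F₁ v‖) w
  set b' := fderiv ℝ (fun v => ‖F₂ v / F₁ v‖) w with hb'
  set b := ‖F₂ w / F₁ w‖
  have hle : ‖deriv (fun v => F₂ v / F₁ v) w‖ ≤ ‖b'‖ := norm_deriv_le_norm_fderiv_norm hd hq
  have hid : ‖F₁ w‖ • b' = (1 - b) • a' - (a' - (‖F₁ w‖ • b' + b • a')) := by
    rw [sub_smul, one_smul]; abel
  calc _ ≤ ‖b'‖ * ‖F₁ w‖ := by gcongr
    _ = ‖‖F₁ w‖ • b'‖ := by rw [norm_smul, norm_norm, mul_comm]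
    _ ≤ ‖(1 - b) • a'‖ + ‖a' - (‖F₁ w‖ • b' + b • a')‖ := by
      rw [hid]
      refine (norm_sub_le _ _).trans (le_of_eq ?_)
      rw [← hid]
    _ = _ := by rw [norm_smul, Real.norm_eq_abs, add_comm]

/-- Zeros with nonzero derivative are isolated. For `h = F₂ / F₁` this makes the zeros of `F₂`
harmless: up to a null set `h' = 0` there. -/
theorem countable_setOf_eq_zero_and_deriv_ne_zero (h : ℂ → ℂ) :
    {w | h w = 0 ∧ deriv h w ≠ 0}.Countable := by
  set S := {w | h w = 0 ∧ deriv h w ≠ 0} with hS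
  have : DiscreteTopology S := by
    refine discreteTopology_subtype_iff.2 fun w hw => ?_
    have hd := (differentiableAt_of_deriv_ne_zero hw.2).hasDerivAt.eventually_ne hw.2 (c := 0)
    rw [inf_principal_eq_bot]
    filter_upwards [hd] with v hv hvS using hv hvS.1
  exact countable_coe_iff.1 (TopologicalSpace.separableSpace_iff_countable.1 inferInstance)

/-! ### Atoll functions on a disc -/

/-- Identity theorem: a non-isolated zero would make `η F` vanish on the whole disc, including at
`p`. -/
theorem eventually_ne_zero_of_mul_differentiableOn {F η : ℂ → ℂ} {z p w : ℂ} {s : ℝ}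
    (hd : DifferentiableOn ℂ (fun w => η w * F w) (Metric.ball z s))
    (hp : p ∈ Metric.ball z s) (hηp : η p ≠ 0) (hFp : F p ≠ 0) (hw : w ∈ Metric.ball z s) :
    ∀ᶠ v in 𝓝[≠] w, η v ≠ 0 := by
  have ha : AnalyticOnNhd ℂ (fun w => η w * F w) (Metric.ball z s) :=
    hd.analyticOnNhd Metric.isOpen_ball
  rcases (ha w hw).eventually_eq_zero_or_eventually_ne_zero with h | h
  · exact absurd (ha.eqOn_zero_of_preconnected_of_eventuallyEq_zero
      (convex_ball z s).isPreconnected hw h hp) (mul_ne_zero hηp hFp)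
  · filter_upwards [h] with v hv using left_ne_zero_of_mul hv

/-- Off the zeros of `η` the quotient is `(η F₂) / (η F₁)`; at an isolated zero of `η` its
continuity makes the singularity removable. -/
theorem differentiableAt_div_of_mul_differentiableOn {F₁ F₂ η : ℂ → ℂ} {z w : ℂ} {s : ℝ}
    (hF₁ : ContinuousOn F₁ (Metric.ball z s)) (hF₂ : ContinuousOn F₂ (Metric.ball z s))
    (hη : ContinuousOn η (Metric.ball z s))
    (hd₁ : DifferentiableOn ℂ (fun w => η w * F₁ w) (Metric.ball z s))
    (hd₂ : DifferentiableOn ℂ (fun w => η w * F₂ w) (Metric.ball z s))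
    (hw : w ∈ Metric.ball z s) (hne : ∀ᶠ v in 𝓝[≠] w, η v ≠ 0) (hw₁ : F₁ w ≠ 0) :
    DifferentiableAt ℂ (fun v => F₂ v / F₁ v) w := by
  have hB : Metric.ball z s ∈ 𝓝 w := Metric.isOpen_ball.mem_nhds hw
  refine (Complex.analyticAt_of_differentiable_on_punctured_nhds_of_continuousAt ?_
    ((hF₂.continuousAt hB).div (hF₁.continuousAt hB) hw₁)).differentiableAt
  filter_upwards [hne, nhdsWithin_le_nhds hB,
    nhdsWithin_le_nhds ((hF₁.continuousAt hB).eventually_ne hw₁)] with v hηv hv hv₁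
  have hBv : Metric.ball z s ∈ 𝓝 v := Metric.isOpen_ball.mem_nhds hv
  refine ((hd₂.differentiableAt hBv).div (hd₁.differentiableAt hBv)
    (mul_ne_zero hηv hv₁)).congr_of_eventuallyEq ?_
  filter_upwards [(hη.continuousAt hBv).eventually_ne hηv] with v' hv'
  exact (mul_div_mul_left _ _ hv').symm

theorem annulus_subset_ball (z : ℂ) (r s : ℝ) : annulus z r s ⊆ Metric.ball z s := fun w hw => by
  rw [mem_ball_iff_norm]
  exact hw.2

theorem annulus_subset_atollDomain (z : ℂ) {r : ℝ} (hr : 0 < r) (s : ℝ) :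
    annulus z r s ⊆ atollDomain (Metric.ball z s) (fun _ : Fin 1 => Metric.ball z r) :=
  fun w hw => ⟨annulus_subset_ball z r s hw, by
    simpa [closure_ball z hr.ne', dist_eq_norm] using hw.1⟩

/-- The atoll domain omits the circle of radius `r` itself; the bound reaches it by a radial limit
from outside. -/
theorem IsAtollFunction.le_norm_of_mem_sphere {z : ℂ} {r s δ Δ R : ℝ} {F : ℂ → ℂ}
    (hF : IsAtollFunction (Metric.ball z s) (fun _ : Fin 1 => Metric.ball z r) δ Δ F)
    (hr : 0 < r) (hR : R ∈ Ico r s) {w : ℂ} (hw : w ∈ Metric.sphere z R) : δ ≤ ‖F w‖ := by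
  have hR0 : 0 ≤ R := hr.le.trans hR.1
  rw [← abs_of_nonneg hR0, ← range_circleMap] at hw
  obtain ⟨θ, rfl⟩ := hw
  have hwB : circleMap z R θ ∈ Metric.ball z s := by
    simpa [dist_eq_norm, abs_of_nonneg hR0] using hR.2
  have hc : ContinuousAt (fun t => ‖F (circleMap z t θ)‖) R := by
    refine ContinuousAt.norm (ContinuousAt.comp (f := fun t => circleMap z t θ) (g := F)
      (hF.contDiffOn.continuousOn.continuousAt (Metric.isOpen_ball.mem_nhds hwB)) ?_)
    exact Continuous.continuousAt (by unfold circleMap; fun_prop)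
  refine ge_of_tendsto (hc.tendsto.mono_left (nhdsWithin_le_nhds (s := Ioi R))) ?_
  filter_upwards [Ioo_mem_nhdsGT hR.2] with t ht
  exact hF.le_norm _ (annulus_subset_atollDomain z hr s
    ((circleMap_mem_annulus_iff (hR0.trans ht.1.le)).2 ⟨hR.1.trans_lt ht.1, ht.2⟩))

/-! ### The quotient on the annulus -/

theorem eLpNorm_two_sq {α E : Type*} [MeasurableSpace α] [NormedAddCommGroup E] (f : α → E)
    (μ : Measure α) : eLpNorm f 2 μ ^ 2 = ∫⁻ x, ‖f x‖ₑ ^ 2 ∂μ := by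
  rw [eLpNorm_eq_lintegral_rpow_enorm_toReal two_ne_zero ENNReal.ofNat_ne_top,
    ← ENNReal.rpow_natCast, ← ENNReal.rpow_mul]
  norm_num

theorem ENNReal.le_of_sq_le_sq {a b : ℝ≥0∞} (h : a ^ 2 ≤ b ^ 2) : a ≤ b :=
  (ENNReal.pow_right_strictMono two_ne_zero).le_iff_le.1 h

/-- The modulus of the quotient of two atoll functions and its derivative are controlled by the
Sobolev norm of the difference of the moduli. -/
theorem eLpNorm_deriv_div_le {F₁ F₂ g : ℂ → ℂ} {A : Set ℂ} {δ Δ : ℝ} (hA : IsOpen A)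
    (hδ : 0 < δ) (hδΔ : δ ≤ Δ) (hF₁ : ContDiffOn ℝ 1 F₁ A) (hF₂ : ContDiffOn ℝ 1 F₂ A)
    (hle : ∀ w ∈ A, δ ≤ ‖F₁ w‖) (hgrad : ∀ w ∈ A, ‖gradient (fun v => ‖F₁ v‖) w‖ ≤ Δ)
    (hd : DifferentiableOn ℂ (fun w => F₂ w / F₁ w) A)
    (hg : HasWeakGradientOn (fun w => ‖F₁ w‖ - ‖F₂ w‖) g A) :
    eLpNorm (deriv fun w => F₂ w / F₁ w) 2 (volume.restrict A) ≤
      ENNReal.ofReal (Δ / δ ^ 2) *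
        (eLpNorm (fun w => ‖F₁ w‖ - ‖F₂ w‖) 2 (volume.restrict A) +
          eLpNorm g 2 (volume.restrict A)) := by
  set u : ℂ → ℝ := fun w => ‖F₁ w‖ - ‖F₂ w‖ with hu
  have hΔ : 0 < Δ := hδ.trans_le hδΔ
  have hne : ∀ w ∈ A, F₁ w ≠ 0 := fun w hw => norm_pos_iff.1 (hδ.trans_le (hle w hw))
  -- The zeros of `F₂` are removed because `|F₂|`, hence `u`, need not be `C¹` there.
  set V := A ∩ F₂ ⁻¹' {0}ᶜ with hVdef
  have hV : IsOpen V := hF₂.continuousOn.isOpen_inter_preimage hA isOpen_compl_singleton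
  have huV : ContDiffOn ℝ 1 u V :=
    ((hF₁.mono inter_subset_left).norm ℝ fun w hw => hne w hw.1).sub
      ((hF₂.mono inter_subset_left).norm ℝ fun w hw => hw.2)
  have hpt : ∀ᵐ w ∂volume.restrict A, ‖deriv (fun w => F₂ w / F₁ w) w‖ ≤
      Δ / δ ^ 2 * ‖(‖u w‖ + ‖g w‖)‖ := by
    rw [ae_restrict_iff' hA.measurableSet]
    filter_upwards [hg.norm_fderiv_le_ae hV inter_subset_left huV,
      (countable_setOf_eq_zero_and_deriv_ne_zero fun w => F₂ w / F₁ w).ae_notMem volume]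
      with w hw hw' hwA
    rw [Real.norm_of_nonneg (by positivity)]
    by_cases h0 : F₂ w = 0
    · have : deriv (fun w => F₂ w / F₁ w) w = 0 := by
        by_contra h
        exact hw' ⟨by simp [h0], h⟩
      rw [this, norm_zero]
      positivity
    · have hwn : A ∈ 𝓝 w := hA.mem_nhds hwA
      have h1 := norm_deriv_div_mul_le ((hF₁.contDiffAt hwn).differentiableAt one_ne_zero)
        (Filter.mem_of_superset hwn hne) h0 (hd.differentiableAt hwn)
      have h2 := hw ⟨hwA, h0⟩
      set a := ‖F₁ w‖ with ha
      have haδ : δ ≤ a := hle w hwA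
      have hapos : 0 < a := hδ.trans_le haδ
      have h3 : |1 - ‖F₂ w / F₁ w‖| = ‖u w‖ / a := by
        rw [hu, norm_div, Real.norm_eq_abs, ← ha, ← abs_of_pos hapos, ← abs_div,
          abs_of_pos hapos, sub_div, div_self hapos.ne']
      have h4 : ‖deriv (fun w => F₂ w / F₁ w) w‖ * a ≤ ‖g w‖ + ‖u w‖ / a * Δ := by
        refine h1.trans (add_le_add h2 ?_)
        rw [h3]
        exact mul_le_mul_of_nonneg_left (hgrad w hwA) (by positivity)
      -- From `δ ≤ Δ` and `δ ≤ a` follows `1 ≤ Δ a / δ²`, so both terms fit the single constant `Δ /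
      -- δ²`.
      have h5 : ‖g w‖ ≤ Δ / δ ^ 2 * ‖g w‖ * a := by
        have : 1 ≤ Δ / δ ^ 2 * a := by
          rw [div_mul_eq_mul_div, le_div_iff₀ (by positivity)]
          nlinarith
        nlinarith [norm_nonneg (g w)]
      have h6 : ‖u w‖ / a * Δ ≤ Δ / δ ^ 2 * ‖u w‖ * a := by
        rw [div_mul_eq_mul_div, div_mul_eq_mul_div, div_mul_eq_mul_div,
          div_le_div_iff₀ hapos (by positivity)]
        have : δ ^ 2 ≤ a * a := by nlinarith
        have h7 : 0 ≤ ‖u w‖ * Δ := by positivity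
        nlinarith
      refine le_of_mul_le_mul_right (h4.trans ?_) hapos
      linarith
  calc _ ≤ ENNReal.ofReal (Δ / δ ^ 2) * eLpNorm (fun w => ‖u w‖ + ‖g w‖) 2 (volume.restrict A) :=
        eLpNorm_le_mul_eLpNorm_of_ae_le_mul hpt 2
    _ ≤ _ := by
        gcongr
        refine (eLpNorm_add_le hg.locallyIntegrableOn.aestronglyMeasurable.norm
          hg.locallyIntegrableOn_gradient.aestronglyMeasurable.norm one_le_two).trans ?_
        rw [eLpNorm_norm, eLpNorm_norm]

/-- The unimodular constant is `a / |a|`, or 1 if `a = 0`, since then `a.arg = 0`. Its distance to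
`a` is `||a| - 1|`, which is at most `|w - a| + |1 - |w||` for every `w`. -/
theorem exists_exp_norm_sub_le (a : ℂ) :
    ∃ α : ℝ, ∀ w : ℂ, ‖w - Complex.exp (-(Complex.I * α))‖ ≤ 2 * ‖w - a‖ + |1 - ‖w‖| := by
  refine ⟨-a.arg, fun w => ?_⟩
  set κ := Complex.exp (-(Complex.I * ((-a.arg : ℝ) : ℂ))) with hκ
  have hκ' : κ = Complex.exp (a.arg * Complex.I) := by
    rw [hκ]
    congr 1
    push_cast
    ring
  have h1 : a - κ = ((‖a‖ - 1 : ℝ) : ℂ) * κ := by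
    have := Complex.norm_mul_exp_arg_mul_I a
    rw [← hκ'] at this
    push_cast
    linear_combination -this
  have h2 : ‖a - κ‖ = |‖a‖ - 1| := by
    rw [h1, norm_mul, hκ', Complex.norm_exp_ofReal_mul_I, mul_one, Complex.norm_real,
      Real.norm_eq_abs]
  have h3 : |‖a‖ - 1| ≤ ‖w - a‖ + |1 - ‖w‖| := by
    have := abs_norm_sub_norm_le a w
    rw [norm_sub_rev] at this
    calc |‖a‖ - 1| = |(‖a‖ - ‖w‖) + (‖w‖ - 1)| := by congr 1; ring
      _ ≤ |‖a‖ - ‖w‖| + |‖w‖ - 1| := abs_add_le _ _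
      _ ≤ _ := by rw [abs_sub_comm ‖w‖ 1]; gcongr
  have h4 := norm_sub_le_norm_sub_add_norm_sub w a κ
  linarith

/-- Puts the trace constant into the form demanded by the theorem: with `k` the argument of
`ENNReal.ofReal` on the right, all reduces to `r (1 + (s - r)²) ≤ (s - r) k²`. -/
theorem ofReal_sq_mul_le_of_trace {r s : ℝ} (hr : 0 < r) (hrs : r < s) {Q X Y W : ℝ≥0∞}
    (hQ : ENNReal.ofReal (r * (s - r)) * Q ≤
      2 * X ^ 2 + 2 * ENNReal.ofReal ((s - r) ^ 2) * Y ^ 2) (hX : X ≤ W) (hY : Y ≤ W) :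
    ENNReal.ofReal (r ^ 2) * Q ≤ (2 * ENNReal.ofReal (r ^ (1 / 2 : ℝ) * (1 / (1 - r / s)) *
      (s ^ (1 / 2 : ℝ) + s ^ (-(1 / 2) : ℝ))) * W) ^ 2 := by
  have hs : 0 < s := hr.trans hrs
  have hsr : 0 < s - r := sub_pos.2 hrs
  set k := r ^ (1 / 2 : ℝ) * (1 / (1 - r / s)) * (s ^ (1 / 2 : ℝ) + s ^ (-(1 / 2) : ℝ)) with hk
  have hρ : 1 / (1 - r / s) = s / (s - r) := by field_simp
  have hk0 : 0 ≤ k := by rw [hk, hρ]; positivity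
  have hk2 : k ^ 2 = r * s * (s + 1) ^ 2 / (s - r) ^ 2 := by
    have h1 : (r ^ (1 / 2 : ℝ)) ^ 2 = r := by
      rw [← Real.sqrt_eq_rpow, Real.sq_sqrt hr.le]
    have h2 : (s ^ (1 / 2 : ℝ)) ^ 2 = s := by
      rw [← Real.sqrt_eq_rpow, Real.sq_sqrt hs.le]
    have h3 : s ^ (-(1 / 2) : ℝ) = (s ^ (1 / 2 : ℝ))⁻¹ := Real.rpow_neg hs.le _
    have h4 : 0 < s ^ (1 / 2 : ℝ) := by positivity
    have h5 : (s ^ (1 / 2 : ℝ) + (s ^ (1 / 2 : ℝ))⁻¹) ^ 2 = (s + 1) ^ 2 / s := by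
      rw [eq_div_iff hs.ne']
      calc _ = (s ^ (1 / 2 : ℝ) + (s ^ (1 / 2 : ℝ))⁻¹) ^ 2 * (s ^ (1 / 2 : ℝ)) ^ 2 := by rw [h2]
        _ = ((s ^ (1 / 2 : ℝ)) ^ 2 + 1) ^ 2 := by field_simp
        _ = _ := by rw [h2]
    rw [hk, hρ, h3, mul_pow, mul_pow, h1, h5]
    field_simp
  have hreal : r * (1 + (s - r) ^ 2) ≤ (s - r) * k ^ 2 := by
    rw [hk2, mul_div_assoc', le_div_iff₀ (by positivity)]
    have : (1 + (s - r) ^ 2) * (s - r) ≤ s * (s + 1) ^ 2 := by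
      have h1 : (1 + (s - r) ^ 2) ≤ (s + 1) ^ 2 := by nlinarith
      nlinarith
    calc _ = r * (s - r) * ((1 + (s - r) ^ 2) * (s - r)) := by ring
      _ ≤ r * (s - r) * (s * (s + 1) ^ 2) := by gcongr
      _ = _ := by ring
  have h0 : ENNReal.ofReal (s - r) ≠ 0 := by simpa using hrs
  rw [← ENNReal.mul_le_mul_iff_right h0 ENNReal.ofReal_ne_top]
  calc ENNReal.ofReal (s - r) * (ENNReal.ofReal (r ^ 2) * Q) =
        ENNReal.ofReal r * (ENNReal.ofReal (r * (s - r)) * Q) := by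
        rw [pow_two, ENNReal.ofReal_mul hr.le, ENNReal.ofReal_mul hr.le]
        ring
    _ ≤ ENNReal.ofReal r * (2 * W ^ 2 + 2 * ENNReal.ofReal ((s - r) ^ 2) * W ^ 2) := by
        gcongr
        exact hQ.trans (by gcongr)
    _ = ENNReal.ofReal (r * (1 + (s - r) ^ 2)) * (2 * W ^ 2) := by
        rw [ENNReal.ofReal_mul hr.le, ENNReal.ofReal_add zero_le_one (by positivity),
          ENNReal.ofReal_one]
        ring
    _ ≤ ENNReal.ofReal ((s - r) * k ^ 2) * (4 * W ^ 2) := by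
        gcongr
        norm_num
    _ = _ := by
        rw [ENNReal.ofReal_mul hsr.le, ENNReal.ofReal_pow hk0]
        ring

/-- The quotient of two atoll functions is close to a unimodular constant, both on the annulus and
on its inner circle. -/
theorem exists_phase_estimate {z : ℂ} {r s δ Δ : ℝ} (hr : 0 < r) (hrs : r < s) (hδ : 0 < δ)
    (hδΔ : δ ≤ Δ) {F₁ F₂ : ℂ → ℂ}
    (hF₁ : IsAtollFunction (Metric.ball z s) (fun _ : Fin 1 => Metric.ball z r) δ Δ F₁)
    (hF₂ : ContDiffOn ℝ 1 F₂ (Metric.ball z s))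
    (hd : ∀ w ∈ Metric.ball z s, F₁ w ≠ 0 → DifferentiableAt ℂ (fun v => F₂ v / F₁ v) w) :
    ∃ α : ℝ, ∀ g, HasWeakGradientOn (fun w => ‖F₁ w‖ - ‖F₂ w‖) g (annulus z r s) →
      ∃ W : ℝ≥0∞, W = ENNReal.ofReal (13 * (1 + s) * (Δ / δ ^ 2)) *
        (eLpNorm (fun w => ‖F₁ w‖ - ‖F₂ w‖) 2 (volume.restrict (annulus z r s)) +
          eLpNorm g 2 (volume.restrict (annulus z r s))) ∧
      eLpNorm (fun w => F₂ w / F₁ w - Complex.exp (-(Complex.I * α))) 2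
        (volume.restrict (annulus z r s)) ≤ W ∧
      ENNReal.ofReal (r ^ 2) * (∫⁻ θ in Ioo (-Real.pi) Real.pi,
        ‖F₂ (circleMap z r θ) / F₁ (circleMap z r θ) - Complex.exp (-(Complex.I * α))‖ₑ ^ 2) ≤
        (2 * ENNReal.ofReal (r ^ (1 / 2 : ℝ) * (1 / (1 - r / s)) *
          (s ^ (1 / 2 : ℝ) + s ^ (-(1 / 2) : ℝ))) * W) ^ 2 := by
  have hs : 0 < s := hr.trans hrs
  have hΔ : 0 < Δ := hδ.trans_le hδΔ
  have hA := isOpen_annulus z r s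
  have hAB := annulus_subset_ball z r s
  -- Unlike the annulus, `U` is an open set containing the inner circle as well, as the trace
  -- inequality requires.
  set U : Set ℂ := Metric.ball z s ∩ F₁ ⁻¹' {0}ᶜ with hUdef
  have hU : IsOpen U :=
    hF₁.contDiffOn.continuousOn.isOpen_inter_preimage Metric.isOpen_ball isOpen_compl_singleton
  set h : ℂ → ℂ := fun w => F₂ w / F₁ w with hh
  have hdU : DifferentiableOn ℂ h U := fun w hw => (hd w hw.1 hw.2).differentiableWithinAt
  have hsU : ∀ R ∈ Ico r s, Metric.sphere z R ⊆ U := fun R hR w hw => by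
    refine ⟨Metric.sphere_subset_closedBall.trans (Metric.closedBall_subset_ball hR.2) hw, ?_⟩
    exact norm_pos_iff.1 (hδ.trans_le (hF₁.le_norm_of_mem_sphere hr hR hw))
  have hle : ∀ w ∈ annulus z r s, δ ≤ ‖F₁ w‖ := fun w hw =>
    hF₁.le_norm w (annulus_subset_atollDomain z hr s hw)
  have hAU : annulus z r s ⊆ U := fun w hw => ⟨hAB hw, norm_pos_iff.1 (hδ.trans_le (hle w hw))⟩
  have hdA : DifferentiableOn ℂ h (annulus z r s) := hdU.mono hAU
  have havg : ∀ R ∈ Ioo r s, Real.circleAverage h z R = Real.circleAverage h z r := fun R hR => by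
    have hsub : Metric.closedBall z R \ Metric.ball z r ⊆ U := fun w hw =>
      hsU (dist w z) ⟨not_lt.1 hw.2, (Metric.mem_closedBall.1 hw.1).trans_lt hR.2⟩ rfl
    refine circleAverage_eq_of_differentiable_on_annulus hr hR.1.le (hdU.continuousOn.mono hsub)
      fun w hw => hdU.differentiableAt (hU.mem_nhds (hsub ?_))
    exact ⟨Metric.ball_subset_closedBall hw.1, fun h' => hw.2 (Metric.ball_subset_closedBall h')⟩
  set a := Real.circleAverage h z r with ha
  -- The phase depends on `a` alone and is fixed before `g`, so the infimum over weak gradients can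
  -- be taken later with the same `α`.
  obtain ⟨α, hα⟩ := exists_exp_norm_sub_le a
  refine ⟨α, fun g hg => ⟨_, rfl, ?_⟩⟩
  set u : ℂ → ℝ := fun w => ‖F₁ w‖ - ‖F₂ w‖ with hu
  set μ := volume.restrict (annulus z r s) with hμ
  set κ := Complex.exp (-(Complex.I * α)) with hκ
  set D := Δ / δ ^ 2 with hD
  have hD0 : 0 < D := by positivity
  set T := eLpNorm u 2 μ + eLpNorm g 2 μ with hT
  have hY : eLpNorm (deriv h) 2 μ ≤ ENNReal.ofReal D * T :=
    eLpNorm_deriv_div_le hA hδ hδΔ (hF₁.contDiffOn.mono hAB) (hF₂.mono hAB) hle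
      (fun w hw => hF₁.norm_gradient_le w (hAB hw)) hdA hg
  have hN : eLpNorm (fun w => 1 - ‖h w‖) 2 μ ≤ ENNReal.ofReal D * T := by
    calc _ ≤ ENNReal.ofReal D * eLpNorm u 2 μ := by
          refine eLpNorm_le_mul_eLpNorm_of_ae_le_mul
            ((ae_restrict_iff' hA.measurableSet).2 (ae_of_all _ fun w hw => ?_)) 2
          have hpos : 0 < ‖F₁ w‖ := hδ.trans_le (hle w hw)
          have h1 : 1 - ‖h w‖ = u w / ‖F₁ w‖ := by
            rw [hh, hu, norm_div, sub_div, div_self hpos.ne']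
          rw [h1, norm_div, norm_norm, div_le_iff₀ hpos, mul_right_comm]
          have : 1 ≤ D * ‖F₁ w‖ := by
            have := hle w hw
            rw [hD, div_mul_eq_mul_div, le_div_iff₀ (by positivity)]
            nlinarith
          nlinarith [norm_nonneg (u w)]
      _ ≤ _ := by gcongr; exact le_self_add
  have hP : eLpNorm (fun w => h w - a) 2 μ ≤
      ENNReal.ofReal (2 * Real.pi * s) * eLpNorm (deriv h) 2 μ := by
    refine ENNReal.le_of_sq_le_sq ?_
    rw [mul_pow, eLpNorm_two_sq, eLpNorm_two_sq]
    exact lintegral_enorm_sub_sq_annulus_le hr.le hdA havg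
  have hcont : ContinuousOn h (annulus z r s) := hdA.continuousOn
  have hm1 : AEStronglyMeasurable (fun w => h w - a) μ :=
    (hcont.sub continuousOn_const).aestronglyMeasurable hA.measurableSet
  have hm2 : AEStronglyMeasurable (fun w => 1 - ‖h w‖) μ :=
    (continuousOn_const.sub hcont.norm).aestronglyMeasurable hA.measurableSet
  have hX : eLpNorm (fun w => h w - κ) 2 μ ≤ ENNReal.ofReal (13 * (1 + s) * D) * T := by
    calc _ ≤ eLpNorm (fun w => 2 * ‖h w - a‖ + ‖1 - ‖h w‖‖) 2 μ :=
          eLpNorm_mono_real fun w => hα (h w)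
      _ ≤ eLpNorm (fun w => 2 * ‖h w - a‖) 2 μ + eLpNorm (fun w => ‖1 - ‖h w‖‖) 2 μ :=
          eLpNorm_add_le (hm1.norm.const_mul 2) hm2.norm one_le_two
      _ ≤ 2 * eLpNorm (fun w => h w - a) 2 μ + eLpNorm (fun w => 1 - ‖h w‖) 2 μ := by
          rw [eLpNorm_norm]
          gcongr
          have := eLpNorm_const_smul_le (c := (2 : ℝ)) (f := fun w => ‖h w - a‖) (p := 2) (μ := μ)
          rw [eLpNorm_norm] at this
          refine this.trans (le_of_eq ?_)
          congr 1
          rw [← ofReal_norm]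
          norm_num
      _ ≤ 2 * (ENNReal.ofReal (2 * Real.pi * s) * (ENNReal.ofReal D * T)) +
          ENNReal.ofReal D * T := by
          gcongr
          exact hP.trans (by gcongr)
      _ = ENNReal.ofReal ((4 * Real.pi * s + 1) * D) * T := by
          rw [ENNReal.ofReal_mul (p := 4 * Real.pi * s + 1) (by positivity),
            ENNReal.ofReal_add (by positivity) zero_le_one,
            ENNReal.ofReal_one, show 4 * Real.pi * s = 2 * (2 * Real.pi * s) by ring,
            ENNReal.ofReal_mul zero_le_two, ENNReal.ofReal_ofNat]
          ring
      -- The constant 13 comes from `4 * π < 13`.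
      _ ≤ _ := by
          gcongr
          nlinarith [Real.pi_lt_d2]
  refine ⟨hX, ?_⟩
  have hYW : eLpNorm (deriv h) 2 μ ≤ ENNReal.ofReal (13 * (1 + s) * D) * T := by
    refine hY.trans ?_
    gcongr
    nlinarith
  refine ofReal_sq_mul_le_of_trace hr hrs ?_ hX hYW
  have htr := lintegral_enorm_sq_circle_le hr hrs hU (hdU.sub_const κ) hsU
  rw [eLpNorm_two_sq, eLpNorm_two_sq]
  simpa only [deriv_sub_const_fun] using htr

/-! ### From the quotient back to `F₁ - e^{iα} F₂` -/

theorem exp_mul_exp_neg (α : ℝ) :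
    Complex.exp (Complex.I * α) * Complex.exp (-(Complex.I * α)) = 1 := by
  rw [← Complex.exp_add, add_neg_cancel, Complex.exp_zero]

theorem norm_sub_exp_mul_eq {a b : ℂ} (ha : a ≠ 0) (α : ℝ) :
    ‖a - Complex.exp (Complex.I * α) * b‖ =
      ‖a‖ * ‖b / a - Complex.exp (-(Complex.I * α))‖ := by
  have h1 : a - Complex.exp (Complex.I * α) * b =
      -(Complex.exp (Complex.I * α) * (a * (b / a - Complex.exp (-(Complex.I * α))))) := by
    rw [mul_sub, mul_div_cancel₀ _ ha]
    linear_combination (-a) * exp_mul_exp_neg α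
  rw [h1, norm_neg, norm_mul, norm_mul, mul_comm Complex.I, Complex.norm_exp_ofReal_mul_I, one_mul]

/-- The dividing circle is null, and `a² + b² ≤ (a + b)²`. -/
theorem eLpNorm_ball_le_add {f : ℂ → ℂ} {z : ℂ} {r : ℝ} (hr : 0 < r) (s : ℝ) :
    eLpNorm f 2 (volume.restrict (Metric.ball z s)) ≤
      eLpNorm f 2 (volume.restrict (annulus z r s)) +
        eLpNorm f 2 (volume.restrict (Metric.ball z r)) := by
  have hae : Metric.ball z s ≤ᵐ[volume] (annulus z r s ∪ Metric.ball z r : Set ℂ) := by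
    have h0 : volume (Metric.sphere z r) = 0 := Measure.addHaar_sphere_of_ne_zero _ _ hr.ne'
    filter_upwards [measure_eq_zero_iff_ae_notMem.1 h0] with w hw hws
    rw [mem_sphere_iff_norm] at hw
    have hws' : ‖w - z‖ < s := mem_ball_iff_norm.1 hws
    rcases lt_or_gt_of_ne hw with h | h
    · exact Or.inr (mem_ball_iff_norm.2 h)
    · exact Or.inl ⟨h, hws'⟩
  refine ENNReal.le_of_sq_le_sq ?_
  calc eLpNorm f 2 (volume.restrict (Metric.ball z s)) ^ 2
      ≤ eLpNorm f 2 (volume.restrict (annulus z r s)) ^ 2 +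
        eLpNorm f 2 (volume.restrict (Metric.ball z r)) ^ 2 := by
        simp only [eLpNorm_two_sq]
        exact (lintegral_mono_set' hae).trans (lintegral_union_le _ _ _)
    _ ≤ _ := by
        rw [add_sq]
        gcongr
        exact le_self_add

theorem enorm_le_of_norm_le {x : ℂ} {C : ℝ} (h : ‖x‖ ≤ C) : ‖x‖ₑ ≤ ENNReal.ofReal C := by
  rw [← ofReal_norm]
  exact ENNReal.ofReal_le_ofReal h

/-- The estimate on the inner disc, from the boundary values of the holomorphic function
`η (F₁ - e^{iα} F₂)`. -/
theorem iInf_mul_eLpNorm_ball_le {F₁ F₂ η : ℂ → ℂ} {z : ℂ} {r s Δ : ℝ} {B : ℝ≥0∞} (α : ℝ)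
    (hr : 0 < r) (hrs : r < s)
    (hd₁ : DifferentiableOn ℂ (fun w => η w * F₁ w) (Metric.ball z s))
    (hd₂ : DifferentiableOn ℂ (fun w => η w * F₂ w) (Metric.ball z s))
    (hle : ∀ w ∈ Metric.sphere z r, ‖F₁ w‖ ≤ Δ) (hne : ∀ w ∈ Metric.sphere z r, F₁ w ≠ 0)
    (hB : ENNReal.ofReal (r ^ 2) * (∫⁻ θ in Ioo (-Real.pi) Real.pi,
        ‖F₂ (circleMap z r θ) / F₁ (circleMap z r θ) - Complex.exp (-(Complex.I * α))‖ₑ ^ 2) ≤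
        B ^ 2)
    (hm : ⨅ w ∈ Metric.ball z r, ‖η w‖ₑ ≠ ⊤) (hM : ⨆ w ∈ Metric.sphere z r, ‖η w‖ₑ ≠ ⊤) :
    (⨅ w ∈ Metric.ball z r, ‖η w‖ₑ) *
        eLpNorm (fun w => F₁ w - Complex.exp (Complex.I * α) * F₂ w) 2
          (volume.restrict (Metric.ball z r)) ≤
      (⨆ w ∈ Metric.sphere z r, ‖η w‖ₑ) * (ENNReal.ofReal Δ * B) := by
  set m := ⨅ w ∈ Metric.ball z r, ‖η w‖ₑ with hmdef
  set M := ⨆ w ∈ Metric.sphere z r, ‖η w‖ₑ with hMdef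
  set f := fun w => F₁ w - Complex.exp (Complex.I * α) * F₂ w with hf
  have hG : DifferentiableOn ℂ (fun w => η w * f w) (Metric.ball z s) :=
    (hd₁.sub (hd₂.const_mul (Complex.exp (Complex.I * α)))).congr fun w _ => by
      simp only [hf, Pi.sub_apply]; ring
  refine ENNReal.le_of_sq_le_sq ?_
  calc (m * eLpNorm f 2 (volume.restrict (Metric.ball z r))) ^ 2
      = ∫⁻ w in Metric.ball z r, m ^ 2 * ‖f w‖ₑ ^ 2 := by
        rw [mul_pow, eLpNorm_two_sq, lintegral_const_mul' _ _ (ENNReal.pow_ne_top hm)]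
    _ ≤ ∫⁻ w in Metric.ball z r, ‖η w * f w‖ₑ ^ 2 := by
        refine lintegral_mono_ae
          ((ae_restrict_iff' Metric.isOpen_ball.measurableSet).2 (ae_of_all _ fun w hw => ?_))
        rw [enorm_mul, mul_pow]
        gcongr
        exact iInf₂_le w hw
    _ ≤ ENNReal.ofReal (r ^ 2) *
        ∫⁻ θ in Ioo (-Real.pi) Real.pi, ‖η (circleMap z r θ) * f (circleMap z r θ)‖ₑ ^ 2 :=
        lintegral_enorm_sq_ball_le hr hrs hG
    _ ≤ ENNReal.ofReal (r ^ 2) * ∫⁻ θ in Ioo (-Real.pi) Real.pi, (M * ENNReal.ofReal Δ) ^ 2 *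
        ‖F₂ (circleMap z r θ) / F₁ (circleMap z r θ) - Complex.exp (-(Complex.I * α))‖ₑ ^ 2 := by
        gcongr with θ
        have hθ := circleMap_mem_sphere z hr.le θ
        have h1 : ‖f (circleMap z r θ)‖ₑ = ‖F₁ (circleMap z r θ)‖ₑ *
            ‖F₂ (circleMap z r θ) / F₁ (circleMap z r θ) - Complex.exp (-(Complex.I * α))‖ₑ := by
          rw [← ofReal_norm, norm_sub_exp_mul_eq (hne _ hθ), ENNReal.ofReal_mul (norm_nonneg _),
            ofReal_norm, ofReal_norm]
        rw [enorm_mul, h1, ← mul_pow, ← mul_assoc]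
        gcongr
        · exact le_iSup₂ (f := fun w (_ : w ∈ Metric.sphere z r) => ‖η w‖ₑ) _ hθ
        · exact enorm_le_of_norm_le (hle _ hθ)
    _ = (M * ENNReal.ofReal Δ) ^ 2 * (ENNReal.ofReal (r ^ 2) * ∫⁻ θ in Ioo (-Real.pi) Real.pi,
        ‖F₂ (circleMap z r θ) / F₁ (circleMap z r θ) - Complex.exp (-(Complex.I * α))‖ₑ ^ 2) := by
        rw [lintegral_const_mul' _ _ (by finiteness), mul_left_comm]
    _ ≤ (M * ENNReal.ofReal Δ) ^ 2 * B ^ 2 := by gcongr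
    _ = _ := by ring

theorem eLpNorm_annulus_le {F₁ F₂ : ℂ → ℂ} {z : ℂ} {r s Δ : ℝ} (α : ℝ)
    (hle : ∀ w ∈ annulus z r s, ‖F₁ w‖ ≤ Δ) (hne : ∀ w ∈ annulus z r s, F₁ w ≠ 0) :
    eLpNorm (fun w => F₁ w - Complex.exp (Complex.I * α) * F₂ w) 2
        (volume.restrict (annulus z r s)) ≤ ENNReal.ofReal Δ *
      eLpNorm (fun w => F₂ w / F₁ w - Complex.exp (-(Complex.I * α))) 2
        (volume.restrict (annulus z r s)) := by
  refine eLpNorm_le_mul_eLpNorm_of_ae_le_mul ((ae_restrict_iff'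
    (isOpen_annulus z r s).measurableSet).2 (ae_of_all _ fun w hw => ?_)) 2
  rw [norm_sub_exp_mul_eq (hne w hw)]
  gcongr
  exact hle w hw

/-- A function which vanishes almost everywhere on the annulus, and becomes holomorphic on the disc
when multiplied by `η`, vanishes on the disc. -/
theorem eq_zero_of_eLpNorm_annulus_eq_zero {f η : ℂ → ℂ} {z : ℂ} {r s : ℝ} (hr : 0 < r)
    (hrs : r < s) (hf : ContinuousOn f (Metric.ball z s))
    (hd : DifferentiableOn ℂ (fun w => η w * f w) (Metric.ball z s))
    (hη : ∀ w ∈ Metric.ball z s, ∀ᶠ v in 𝓝[≠] w, η v ≠ 0)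
    (h : eLpNorm f 2 (volume.restrict (annulus z r s)) = 0) {w : ℂ} (hw : w ∈ Metric.ball z s) :
    f w = 0 := by
  have hA := isOpen_annulus z r s
  have hfA : ContinuousOn f (annulus z r s) := hf.mono (annulus_subset_ball z r s)
  rw [eLpNorm_eq_zero_iff (hfA.aestronglyMeasurable hA.measurableSet) two_ne_zero] at h
  have h0 : EqOn f 0 (annulus z r s) :=
    Measure.eqOn_open_of_ae_eq h hA hfA continuousOn_const
  have hp : circleMap z ((r + s) / 2) 0 ∈ annulus z r s :=
    (circleMap_mem_annulus_iff (by linarith)).2 ⟨by linarith, by linarith⟩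
  have hG : EqOn (fun w => η w * f w) 0 (Metric.ball z s) :=
    (hd.analyticOnNhd Metric.isOpen_ball).eqOn_zero_of_preconnected_of_eventuallyEq_zero
      (convex_ball z s).isPreconnected (annulus_subset_ball z r s hp)
      (Filter.mem_of_superset (hA.mem_nhds hp) fun v hv => by
        simp [h0 hv])
  have hB : Metric.ball z s ∈ 𝓝 w := Metric.isOpen_ball.mem_nhds hw
  have hlim : Tendsto f (𝓝[≠] w) (𝓝 (f w)) := (hf.continuousAt hB).tendsto.mono_left inf_le_left
  refine tendsto_nhds_unique hlim (tendsto_const_nhds.congr' ?_)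
  filter_upwards [hη w hw, nhdsWithin_le_nhds hB] with v hv hvB
  exact ((mul_eq_zero.1 (hG hvB)).resolve_left hv).symm

theorem mainTheorem5 :
    ∃ (ρ : ℝ → ℝ) (c : ℝ),
      ContinuousOn ρ (Ico 0 1) ∧ (∀ t ∈ Ico (0 : ℝ) 1, 0 < ρ t) ∧
      Tendsto ρ (𝓝[<] 1) atTop ∧ 0 < c ∧
      ∀ (z : ℂ) (r s δ Δ : ℝ), 0 < r → r < s → 0 < δ → δ ≤ Δ →
      ∀ F₁ F₂ η : ℂ → ℂ,
        IsAtollFunction (Metric.ball z s) (fun _ : Fin 1 => Metric.ball z r) δ Δ F₁ →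
        ContDiffOn ℝ 1 F₂ (Metric.ball z s) →
        ContinuousOn η (Metric.ball z s) →
        DifferentiableOn ℂ (fun w => η w * F₁ w) (Metric.ball z s) →
        DifferentiableOn ℂ (fun w => η w * F₂ w) (Metric.ball z s) →
        (∃ w ∈ Metric.sphere z r, η w ≠ 0) →
        (⨅ α : ℝ, eLpNorm (fun w => F₁ w - Complex.exp (Complex.I * α) * F₂ w) 2
            (volume.restrict (Metric.ball z s))) ≤
          ENNReal.ofReal (c * (1 + ρ (r / s) * s)) *
          (1 + ENNReal.ofReal (r ^ (1 / 2 : ℝ) * ρ (r / s) *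
              (s ^ (1 / 2 : ℝ) + s ^ (-(1 / 2) : ℝ))) * etaVar η (Metric.ball z r)) *
          ENNReal.ofReal (Δ ^ 2 / δ ^ 2) *
          sobolevNorm (fun w => ‖F₁ w‖ - ‖F₂ w‖) (annulus z r s) := by
  -- Here `26 = 2 * 13`: 13 from the phase estimate and 2 from the trace bound `2 * k * W`.
  refine ⟨fun t => 1 / (1 - t), 26, ?_, ?_, ?_, by norm_num, ?_⟩
  · exact continuousOn_const.div (by fun_prop) fun t ht => (sub_pos.2 ht.2).ne'
  · exact fun t ht => one_div_pos.2 (sub_pos.2 ht.2)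
  · simp_rw [one_div]
    refine tendsto_inv_nhdsGT_zero.comp (tendsto_nhdsWithin_iff.2 ⟨?_, ?_⟩)
    · exact (Continuous.tendsto' (by fun_prop) 1 0 (by norm_num)).mono_left inf_le_left
    · filter_upwards [self_mem_nhdsWithin] with t ht using sub_pos.2 (mem_Iio.1 ht)
  intro z r s δ Δ hr hrs hδ hδΔ F₁ F₂ η hF₁ hF₂ hη hd₁ hd₂ ⟨p, hp, hηp⟩
  have hs : 0 < s := hr.trans hrs
  have hΔ : 0 < Δ := hδ.trans_le hδΔ
  have hball : Metric.closedBall z r ⊆ Metric.ball z s := Metric.closedBall_subset_ball hrs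
  have hsph : Metric.sphere z r ⊆ Metric.ball z s := Metric.sphere_subset_closedBall.trans hball
  have hAB := annulus_subset_ball z r s
  have hneS : ∀ w ∈ Metric.sphere z r, F₁ w ≠ 0 := fun w hw =>
    norm_pos_iff.1 (hδ.trans_le (hF₁.le_norm_of_mem_sphere hr ⟨le_rfl, hrs⟩ hw))
  have hneA : ∀ w ∈ annulus z r s, F₁ w ≠ 0 := fun w hw =>
    norm_pos_iff.1 (hδ.trans_le (hF₁.le_norm w (annulus_subset_atollDomain z hr s hw)))
  have hηne : ∀ w ∈ Metric.ball z s, ∀ᶠ v in 𝓝[≠] w, η v ≠ 0 := fun w hw =>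
    eventually_ne_zero_of_mul_differentiableOn hd₁ (hsph hp) hηp (hneS p hp) hw
  have hquot : ∀ w ∈ Metric.ball z s, F₁ w ≠ 0 → DifferentiableAt ℂ (fun v => F₂ v / F₁ v) w :=
    fun w hw => differentiableAt_div_of_mul_differentiableOn hF₁.contDiffOn.continuousOn
      hF₂.continuousOn hη hd₁ hd₂ hw (hηne w hw)
  obtain ⟨α, hα⟩ := exists_phase_estimate hr hrs hδ hδΔ hF₁ hF₂ hquot
  set u : ℂ → ℝ := fun w => ‖F₁ w‖ - ‖F₂ w‖ with hu
  set μ := volume.restrict (annulus z r s) with hμ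
  set f : ℂ → ℂ := fun w => F₁ w - Complex.exp (Complex.I * α) * F₂ w with hf
  refine (iInf_le _ α).trans ?_
  set k := r ^ (1 / 2 : ℝ) * (1 / (1 - r / s)) * (s ^ (1 / 2 : ℝ) + s ^ (-(1 / 2) : ℝ)) with hk
  have hrs1 : 0 < 1 - r / s := by
    rw [sub_pos, div_lt_one hs]
    exact hrs
  have hk0 : 0 < k := by positivity
  set C := ENNReal.ofReal (13 * (1 + s) * (Δ / δ ^ 2)) with hC
  have hann : ∀ g, HasWeakGradientOn u g (annulus z r s) →
      eLpNorm f 2 μ ≤ ENNReal.ofReal Δ * (C * (eLpNorm u 2 μ + eLpNorm g 2 μ)) := fun g hg => by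
    obtain ⟨W, rfl, hX, -⟩ := hα g hg
    refine (eLpNorm_annulus_le α (fun w hw => hF₁.norm_le w (hAB hw)) hneA).trans ?_
    gcongr
  set m := ⨅ w ∈ Metric.ball z r, ‖η w‖ₑ with hmdef
  set M := ⨆ w ∈ Metric.sphere z r, ‖η w‖ₑ with hMdef
  have hvar : etaVar η (Metric.ball z r) = M / m := by
    rw [etaVar, frontier_ball z hr.ne']
  have hm : m ≠ ⊤ :=
    ((iInf₂_le z (Metric.mem_ball_self hr)).trans_lt enorm_lt_top).ne
  have hM0 : M ≠ 0 := by
    have h1 : ‖η p‖ₑ ≤ M := le_iSup₂ (f := fun w (_ : w ∈ Metric.sphere z r) => ‖η w‖ₑ) p hp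
    exact fun h => hηp (by simpa [h] using h1)
  have hM : M ≠ ⊤ := by
    obtain ⟨B, hB⟩ := (isCompact_sphere z r).exists_bound_of_continuousOn (hη.mono hsph)
    exact ((iSup₂_le fun w hw => enorm_le_of_norm_le (hB w hw)).trans_lt ENNReal.ofReal_lt_top).ne
  rw [hvar]
  set K := ENNReal.ofReal (26 * (1 + 1 / (1 - r / s) * s)) *
    (1 + ENNReal.ofReal k * (M / m)) * ENNReal.ofReal (Δ ^ 2 / δ ^ 2) with hK
  have hK1 : ENNReal.ofReal (26 * (1 + 1 / (1 - r / s) * s)) ≠ 0 := by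
    rw [Ne, ENNReal.ofReal_eq_zero, not_le]
    positivity
  have hK2 : ENNReal.ofReal (Δ ^ 2 / δ ^ 2) ≠ 0 := by
    rw [Ne, ENNReal.ofReal_eq_zero, not_le]
    positivity
  have hK0 : K ≠ 0 := mul_ne_zero (mul_ne_zero hK1 (by simp)) hK2
  -- If `m = 0` then `K = ∞`, and only a vanishing Sobolev norm needs an argument: the annulus
  -- estimate, which does not involve `m`, gives `f = 0` there, and this spreads to the disc.
  by_cases hm0 : m = 0
  · have hKtop : K = ⊤ := by
      have hk0' : ENNReal.ofReal k ≠ 0 := by simpa using hk0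
      rw [hK, hm0, ENNReal.div_zero hM0, ENNReal.mul_top hk0', add_top, ENNReal.mul_top hK1,
        ENNReal.top_mul hK2]
    by_cases hS : sobolevNorm u (annulus z r s) = 0
    · have h0 : eLpNorm f 2 μ = 0 := by
        have hCf : ENNReal.ofReal Δ * C ≠ ⊤ := by finiteness
        have hCf0 : ENNReal.ofReal Δ * C ≠ 0 := by
          refine mul_ne_zero (by simpa using hΔ) ?_
          rw [hC, Ne, ENNReal.ofReal_eq_zero, not_le]
          positivity
        have : eLpNorm f 2 μ ≤ ENNReal.ofReal Δ * C * sobolevNorm u (annulus z r s) := by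
          rw [sobolevNorm, ENNReal.mul_iInf_of_ne hCf0 hCf]
          refine le_iInf fun g => ?_
          rw [ENNReal.mul_iInf_of_ne hCf0 hCf]
          exact le_iInf fun hg => by simpa only [mul_assoc] using hann g hg
        rw [hS, mul_zero] at this
        exact le_antisymm this zero_le
      have hfη : DifferentiableOn ℂ (fun w => η w * f w) (Metric.ball z s) :=
        (hd₁.sub (hd₂.const_mul (Complex.exp (Complex.I * α)))).congr fun w _ => by
          simp only [hf, Pi.sub_apply]; ring
      have hfB : ∀ w ∈ Metric.ball z s, f w = 0 := fun w hw =>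
        eq_zero_of_eLpNorm_annulus_eq_zero hr hrs
          (hF₁.contDiffOn.continuousOn.sub (continuousOn_const.mul hF₂.continuousOn))
          hfη hηne h0 hw
      refine le_of_eq_of_le ?_ zero_le
      rw [eLpNorm_congr_ae (g := 0) ((ae_restrict_iff' Metric.isOpen_ball.measurableSet).2
        (ae_of_all _ hfB)), eLpNorm_zero]
    · rw [hKtop, ENNReal.top_mul hS]
      exact le_top
  have hvartop : M / m ≠ ⊤ := ENNReal.div_ne_top hM hm0
  have hKtop : K ≠ ⊤ := by finiteness
  -- Now `K` is finite and nonzero, so it passes inside the infimum over weak gradients.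
  rw [sobolevNorm, ENNReal.mul_iInf_of_ne hK0 hKtop]
  refine le_iInf fun g => ?_
  rw [ENNReal.mul_iInf_of_ne hK0 hKtop]
  refine le_iInf fun hg => ?_
  set T := eLpNorm u 2 μ + eLpNorm g 2 μ with hT
  obtain ⟨W, hW, -, hQ⟩ := hα g hg
  have hin := iInf_mul_eLpNorm_ball_le α hr hrs hd₁ hd₂ (fun w hw => hF₁.norm_le w (hsph hw)) hneS
    hQ hm hM
  have hin' : eLpNorm f 2 (volume.restrict (Metric.ball z r)) ≤
      M / m * (ENNReal.ofReal Δ * (2 * ENNReal.ofReal k * W)) := by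
    rw [← ENNReal.mul_div_right_comm, ENNReal.le_div_iff_mul_le (Or.inl hm0) (Or.inl hm), mul_comm]
    exact hin
  have hconst : ENNReal.ofReal Δ * (2 * C) ≤
      ENNReal.ofReal (26 * (1 + 1 / (1 - r / s) * s)) * ENNReal.ofReal (Δ ^ 2 / δ ^ 2) := by
    rw [hC, ← ENNReal.ofReal_ofNat 2, ← ENNReal.ofReal_mul (by norm_num),
      ← ENNReal.ofReal_mul hΔ.le, ← ENNReal.ofReal_mul (by positivity)]
    refine ENNReal.ofReal_le_ofReal ?_
    have h1 : 1 ≤ 1 / (1 - r / s) := by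
      rw [le_div_iff₀ hrs1]
      have : 0 < r / s := by positivity
      linarith
    calc Δ * (2 * (13 * (1 + s) * (Δ / δ ^ 2))) = 26 * (1 + 1 * s) * (Δ ^ 2 / δ ^ 2) := by ring
      _ ≤ _ := by gcongr
  calc _ ≤ ENNReal.ofReal Δ * W + M / m * (ENNReal.ofReal Δ * (2 * ENNReal.ofReal k * W)) := by
        refine (eLpNorm_ball_le_add hr s).trans (add_le_add ?_ hin')
        rw [hW]
        exact hann g hg
    -- The annulus term is doubled so that both terms share the factor `Δ * (2 * C)`.
    _ ≤ ENNReal.ofReal Δ * (2 * W) + M / m * (ENNReal.ofReal Δ * (2 * ENNReal.ofReal k * W)) := by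
        gcongr
        exact le_mul_of_one_le_left zero_le one_le_two
    _ = ENNReal.ofReal Δ * (2 * C) * (1 + ENNReal.ofReal k * (M / m)) * T := by
        rw [hW]
        ring
    _ ≤ ENNReal.ofReal (26 * (1 + 1 / (1 - r / s) * s)) * ENNReal.ofReal (Δ ^ 2 / δ ^ 2) *
        (1 + ENNReal.ofReal k * (M / m)) * T := by gcongr
    _ = _ := by
        rw [hK]
        ring
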